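/- **Conventions.** All sets are finite, and $a=b\pm\varepsilon$ means $|a-b|\le\varepsilon$. A bigraph $(U,V;E)$ consists of two vertex sets and a set $E\subseteq U\times V$; its density is $|E|/(|U||V|)$. It is *irreducible* if no two distinct elements of $U$ have the same neighbours in $V$ and no two distinct elements of $V$ have the same neighbours in $U$. A bigraph $(X,Y;E)$ of density $d_0$ has $\mathrm{dev}_2(\varepsilon,d)$ if $d_0=d\pm\varepsilon$ and $\sum_{x_0,x_1\in X}\sum_{y_0,y_1\in Y}\prod_{i,j\in\{0,1\}}g(x_i,y_j)\le\varepsilon|X|^2|Y|^2$, where $g=1-d_0$ on $E$ and $g=-d_0$ off $E$; it has $\mathrm{dev}_2(\varepsilon)$ if it has $\mathrm{dev}_2(\varepsilon,d_0)$. A triad $T=(X,Y,Z;E_{XY},E_{YZ},E_{XZ})$ consists of three vertex sets and bigraphs between them; $K_3(T)$ is its set of triangles $(x,y,z)\in X\times Y\times Z$. For a $3$-graph (3-uniform hypergraph) $H$, the triad $T$ has $\mathrm{dev}_{2,3}(\varepsilon_1,\varepsilon_2)$ with respect to $H$ if there are $d_{XY},d_{YZ},d_{XZ}>0$ such that its three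 bigraphs have $\mathrm{dev}_2(\varepsilon_2,d_{XY})$, $\mathrm{dev}_2(\varepsilon_2,d_{YZ})$, $\mathrm{dev}_2(\varepsilon_2,d_{XZ})$ respectively and $$\sum_{x_0,x_1\in X}\sum_{y_0,y_1\in Y}\sum_{z_0,z_1\in Z}\ \prod_{i,j,k\in\{0,1\}}h(x_i,y_j,z_k)\le\varepsilon_1\,d_{XY}^4d_{YZ}^4d_{XZ}^4\,|X|^2|Y|^2|Z|^2 ,$$ where, with $d$ the proportion of triples $(x,y,z)$ of $K_3(T)$ with $\{x,y,z\}\in E(H)$, $h=1-d$ on those triples, $h=-d$ on the rest of $K_3(T)$, and $h=0$ outside $K_3(T)$. For $t,\ell\ge1$, a $(t,\ell)$-decomposition of a set $W$ consists of a partition $W=V_1\sqcup\dots\sqcup V_t$ and, for all $1\le i,j\le t$, a partition $V_i\times V_j=P_{ij}^1\sqcup\dots\sqcup P_{ij}^\ell$ (empty parts are allowed). Its triads are the $(V_i,V_j,V_k;P_{ij}^{a},P_{jk}^{c},P_{ik}^{b})$. It is a $(t,\ell,\varepsilon_1,\varepsilon_2)$-decomposition if at least $(1-\varepsilon_1)|W|^2$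 pairs $(x,y)\in W^2$ lie in some $P_{ij}^a$ such that $(V_i,V_j;P_{ij}^a)$ has $\mathrm{dev}_2(\varepsilon_2)$. Such a decomposition of the vertex set $W$ of a $3$-graph $H$ is $\mathrm{dev}_{2,3}(\varepsilon_1,\varepsilon_2)$-*regular* if all but at most $\varepsilon_1|W|^3$ triples in $W^3$ lie in $K_3(T)$ for some triad $T$ of it that has $\mathrm{dev}_{2,3}(\varepsilon_1,\varepsilon_2)$ with respect to $H$. A bipartite $U$-coloured graph $\Gamma=(A\cup B,(P_u)_{u\in U})$ consists of disjoint sets $A,B$ and a partition of the set of pairs $ab$ $(a\in A,\ b\in B)$ into edge sets $P_u$. A bipartite graph $(A\cup B,P)$ is $\varepsilon$-regular if $|d(A,B)-d(A',B')|\le\varepsilon$ for all $A'\subseteq A$, $B'\subseteq B$ with $|A'|\ge\varepsilon|A|$, $|B'|\ge\varepsilon|B|$, where $d(X,Y)$ denotes the edge density between $X$ and $Y$; its density is $d(A,B)$. For an integer $m\ge1$, an $(m,\Gamma)$-*blowup* of a bigraph $\mathcal G=(U,V;E)$ is a $3$-graph $H$ whose vertex set is a disjoint union $A\sqcup B\sqcup\bigsqcup_{v\in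 V}C_v$ with $|C_v|=m$, such that for all $u\in U$, $v\in V$, $xy\in P_u$, $z\in C_v$: $xyz\in E(H)$ if $(u,v)\in E$, and $xyz\notin E(H)$ if $(u,v)\notin E$ (all other triples are arbitrary). **Proposition.** There are constants $K_1,\varepsilon^*>0$ so that the following holds. Let $\mathcal G=(U,V;E)$ be an irreducible bigraph with $U,V$ nonempty, and let $$0<\varepsilon_1<\min\{|U|^{-K_1},|V|^{-K_1},(\varepsilon^*)^{K_1}\}.$$ There exists $\varepsilon_2^*:\mathbb N\to(0,1)$ so that for all $t\ge1$ and all $\varepsilon_2:\mathbb N\to(0,1)$ satisfying $\varepsilon_2(x)<\varepsilon_2^*(x)$ for all $x$, there is $\varepsilon>0$ so that for all sufficiently large $n$ divisible by $|V|$ the following holds. Suppose $\Gamma=(A\cup B,(P_u)_{u\in U})$ is a bipartite $U$-coloured graph with $|A|=|B|=n$ such that for each $u\in U$, $(A\cup B,P_u)$ is $\varepsilon$-regular with density $|U|^{-1}\pm\varepsilon$. Suppose $H$ is an $(n/|V|,\Gamma)$-blowup of $\mathcal G$, $\ell\ge1$, and $\mathcal P$ is a $\mathrm{dev}_{2,3}(\varepsilon_1^{K_1},\varepsilon_2(\ell)^{K_1})$-regular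 $(t,\ell,\varepsilon_1^{K_1},\varepsilon_2(\ell)^{K_1})$-decomposition of $H$. Then $\ell\ge|U|$. -/

import Mathlib

open scoped BigOperators

noncomputable section

/-! ### Bigraphs -/

/-- A bigraph `(U, V; E)`: two finite vertex sets and `E ⊆ U × V`. The vertex sets need not be
disjoint, and may even coincide. -/
structure Bigraph (α β : Type*) where
  left : Finset α
  right : Finset β
  edges : Finset (α × β)
  edges_subset : edges ⊆ left ×ˢ right

namespace Bigraph

variable {α β : Type*}

/-- `x ∼ y` for `x, y ∈ U`: they have the same neighbours in `V`. -/
def LeftEquiv (G : Bigraph α β) (x y : α) : Prop :=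
  ∀ z ∈ G.right, (x, z) ∈ G.edges ↔ (y, z) ∈ G.edges

/-- `x ∼ y` for `x, y ∈ V`: they have the same neighbours in `U`. -/
def RightEquiv (G : Bigraph α β) (x y : β) : Prop :=
  ∀ z ∈ G.left, (z, x) ∈ G.edges ↔ (z, y) ∈ G.edges

/-- A bigraph is irreducible if all classes of both twin relations are singletons. -/
def Irreducible (G : Bigraph α β) : Prop :=
  (∀ x ∈ G.left, ∀ y ∈ G.left, G.LeftEquiv x y → x = y) ∧
  (∀ x ∈ G.right, ∀ y ∈ G.right, G.RightEquiv x y → x = y)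

/-- The density `|E| / (|U| |V|)`. -/
def density (G : Bigraph α β) : ℝ :=
  (G.edges.card : ℝ) / ((G.left.card : ℝ) * (G.right.card : ℝ))

open Classical in
/-- The balanced function: `1 - d` on edges and `-d` on non-edges. -/
def balanced (G : Bigraph α β) (x : α) (y : β) : ℝ :=
  if (x, y) ∈ G.edges then 1 - G.density else -G.density

/-- The bigraph has `dev₂(ε, d)`. -/
def HasDev2 (G : Bigraph α β) (ε d : ℝ) : Prop :=
  |G.density - d| ≤ ε ∧
  ∑ u₀ ∈ G.left, ∑ u₁ ∈ G.left, ∑ w₀ ∈ G.right, ∑ w₁ ∈ G.right,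
      G.balanced u₀ w₀ * G.balanced u₀ w₁ * G.balanced u₁ w₀ * G.balanced u₁ w₁
    ≤ ε * (G.left.card : ℝ) ^ 2 * (G.right.card : ℝ) ^ 2

/-- The bigraph has `dev₂(ε)`, i.e. `dev₂(ε, d)` for its own density `d`. -/
def HasDev2Self (G : Bigraph α β) (ε : ℝ) : Prop := G.HasDev2 ε G.density

end Bigraph

/-! ### Trigraphs and triads -/

/-- A trigraph `(X, Y, Z; E)` with `E ⊆ X × Y × Z`. -/
structure Trigraph (W : Type*) where
  X : Finset W
  Y : Finset W
  Z : Finset W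
  edges : Finset (W × W × W)
  edges_subset : edges ⊆ X ×ˢ Y ×ˢ Z

/-- A triad `(X, Y, Z; E_XY, E_YZ, E_XZ)`. -/
structure Triad (W : Type*) where
  X : Finset W
  Y : Finset W
  Z : Finset W
  edgesXY : Finset (W × W)
  edgesYZ : Finset (W × W)
  edgesXZ : Finset (W × W)
  edgesXY_subset : edgesXY ⊆ X ×ˢ Y
  edgesYZ_subset : edgesYZ ⊆ Y ×ˢ Z
  edgesXZ_subset : edgesXZ ⊆ X ×ˢ Z

namespace Triad

variable {W : Type*}

/-- The component bigraph `G[X, Y]`. -/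
def bigraphXY (G : Triad W) : Bigraph W W := ⟨G.X, G.Y, G.edgesXY, G.edgesXY_subset⟩

/-- The component bigraph `G[Y, Z]`. -/
def bigraphYZ (G : Triad W) : Bigraph W W := ⟨G.Y, G.Z, G.edgesYZ, G.edgesYZ_subset⟩

/-- The component bigraph `G[X, Z]`. -/
def bigraphXZ (G : Triad W) : Bigraph W W := ⟨G.X, G.Z, G.edgesXZ, G.edgesXZ_subset⟩

open Classical in
/-- The set `K₃(G)` of ordered triangles of the triad. -/
def triangles (G : Triad W) : Finset (W × W × W) :=
  (G.X ×ˢ G.Y ×ˢ G.Z).filter fun p =>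
    (p.1, p.2.1) ∈ G.edgesXY ∧ (p.2.1, p.2.2) ∈ G.edgesYZ ∧ (p.1, p.2.2) ∈ G.edgesXZ

end Triad

namespace Trigraph

variable {W : Type*}

open Classical in
/-- The restriction `H|G` of a trigraph to the triangles of a triad. -/
def restrict (H : Trigraph W) (G : Triad W) : Trigraph W where
  X := G.X
  Y := G.Y
  Z := G.Z
  edges := H.edges ∩ G.triangles
  edges_subset := Finset.inter_subset_right.trans (Finset.filter_subset _ _)

open Classical in
/-- The density `d_H(G) = |E(H) ∩ K₃(G)| / |K₃(G)|` of a trigraph relative to a triad. -/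
def relDensity (H : Trigraph W) (G : Triad W) : ℝ :=
  ((H.edges ∩ G.triangles).card : ℝ) / (G.triangles.card : ℝ)

open Classical in
/-- The function `h_{H,G}`: it is `1 - d_H(G)` on the triangles of `G` that are edges of `H`,
`-d_H(G)` on the other triangles of `G`, and `0` elsewhere. -/
def relBalanced (H : Trigraph W) (G : Triad W) (x y z : W) : ℝ :=
  if (x, y, z) ∈ G.triangles then
    if (x, y, z) ∈ H.edges then 1 - H.relDensity G else -H.relDensity G
  else 0

/-- `(H, G)` has `dev_{2,3}(ε₁, ε₂)`, for a trigraph `H` and a triad `G` underlying it. -/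
def HasDev23 (H : Trigraph W) (G : Triad W) (ε₁ ε₂ : ℝ) : Prop :=
  ∃ dXY dYZ dXZ : ℝ, 0 < dXY ∧ 0 < dYZ ∧ 0 < dXZ ∧
    G.bigraphXY.HasDev2 ε₂ dXY ∧ G.bigraphXZ.HasDev2 ε₂ dXZ ∧ G.bigraphYZ.HasDev2 ε₂ dYZ ∧
    ∑ x₀ ∈ G.X, ∑ x₁ ∈ G.X, ∑ y₀ ∈ G.Y, ∑ y₁ ∈ G.Y, ∑ z₀ ∈ G.Z, ∑ z₁ ∈ G.Z,
        H.relBalanced G x₀ y₀ z₀ * H.relBalanced G x₀ y₀ z₁ *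
        H.relBalanced G x₀ y₁ z₀ * H.relBalanced G x₀ y₁ z₁ *
        H.relBalanced G x₁ y₀ z₀ * H.relBalanced G x₁ y₀ z₁ *
        H.relBalanced G x₁ y₁ z₀ * H.relBalanced G x₁ y₁ z₁
      ≤ ε₁ * dXY ^ 4 * dYZ ^ 4 * dXZ ^ 4 *
        (G.X.card : ℝ) ^ 2 * (G.Y.card : ℝ) ^ 2 * (G.Z.card : ℝ) ^ 2

end Trigraph

/-! ### 3-graphs -/

namespace Hypergraph

variable {W : Type*}

/-- `H` is a `3`-graph (3-uniform hypergraph) whose vertex set is all of `W`. -/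
structure IsThreeGraph (H : Hypergraph W) : Prop where
  vertexSet_eq : H.vertexSet = Set.univ
  ncard_edge : ∀ e ∈ H.edgeSet, e.ncard = 3

open Classical in
/-- The trigraph `(W, W, W; {(x, y, z) : xyz ∈ E(H)})`. -/
def toTrigraph [Fintype W] (H : Hypergraph W) : Trigraph W where
  X := Finset.univ
  Y := Finset.univ
  Z := Finset.univ
  edges := Finset.univ.filter fun p => ({p.1, p.2.1, p.2.2} : Set W) ∈ H.edgeSet
  edges_subset := fun _ _ => by simp

end Hypergraph

/-! ### Regular decompositions -/

/-- A `(t, ℓ)`-decomposition of `W`: a partition of `W` into parts `V_i`, `i ∈ [t]`, and for all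
`i, j` a partition of `V_i × V_j` into cells `P_ij^α`, `α ∈ [ℓ]`. Parts and cells may be empty. -/
structure Decomposition (W : Type*) (t ℓ : ℕ) where
  part : Fin t → Finset W
  existsUnique_part : ∀ x, ∃! i, x ∈ part i
  cell : Fin t → Fin t → Fin ℓ → Finset (W × W)
  cell_subset : ∀ i j a, cell i j a ⊆ part i ×ˢ part j
  existsUnique_cell : ∀ i j, ∀ x ∈ part i, ∀ y ∈ part j, ∃! a, (x, y) ∈ cell i j a

namespace Decomposition

variable {W : Type*} {t ℓ : ℕ}

/-- The bigraph `(V_i, V_j; P_ij^α)`. -/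
def bigraph (P : Decomposition W t ℓ) (i j : Fin t) (a : Fin ℓ) : Bigraph W W :=
  ⟨P.part i, P.part j, P.cell i j a, P.cell_subset i j a⟩

/-- The triad `(V_i, V_j, V_k; P_ij^α, P_ik^β, P_jk^γ)` of the decomposition. -/
def triad (P : Decomposition W t ℓ) (i j k : Fin t) (a b c : Fin ℓ) : Triad W where
  X := P.part i
  Y := P.part j
  Z := P.part k
  edgesXY := P.cell i j a
  edgesYZ := P.cell j k c
  edgesXZ := P.cell i k b
  edgesXY_subset := P.cell_subset i j a
  edgesYZ_subset := P.cell_subset j k c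
  edgesXZ_subset := P.cell_subset i k b

open Classical in
/-- `P` is a `(t, ℓ, ε₁, ε₂)`-decomposition: at least `(1 - ε₁) |W|²` pairs lie in some cell
that has `dev₂(ε₂)`. -/
def IsQuasirandom [Fintype W] (P : Decomposition W t ℓ) (ε₁ ε₂ : ℝ) : Prop :=
  (1 - ε₁) * (Fintype.card W : ℝ) ^ 2 ≤
    ((Finset.univ.filter fun p : W × W =>
      ∃ i j a, p ∈ P.cell i j a ∧ (P.bigraph i j a).HasDev2Self ε₂).card : ℝ)

open Classical in
/-- `P` is `dev_{2,3}(ε₁, ε₂)`-regular with respect to the `3`-graph `H`: it is a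
`(t, ℓ, ε₁, ε₂)`-decomposition, and all but at most `ε₁ |W|³` triples are triangles of some triad
`G` of `P` such that `(H|G, G)` has `dev_{2,3}(ε₁, ε₂)`. -/
def IsRegular [Fintype W] (P : Decomposition W t ℓ) (H : Hypergraph W) (ε₁ ε₂ : ℝ) : Prop :=
  P.IsQuasirandom ε₁ ε₂ ∧
  ((Finset.univ.filter fun p : W × W × W =>
      ¬ ∃ i j k a b c, p ∈ (P.triad i j k a b c).triangles ∧
        (H.toTrigraph.restrict (P.triad i j k a b c)).HasDev23 (P.triad i j k a b c) ε₁ ε₂).card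
      : ℝ) ≤ ε₁ * (Fintype.card W : ℝ) ^ 3

end Decomposition

/-! ### Coloured bipartite graphs and blowups -/

open Classical in
/-- The density `d_G(X, Y)` of a graph between two vertex sets, as a real number. -/
def SimpleGraph.pairDensity {W : Type*} (G : SimpleGraph W) (X Y : Finset W) : ℝ :=
  ((G.edgeDensity X Y : ℚ) : ℝ)

/-- A bipartite graph `G` with parts `A`, `B` is `ε`-regular. -/
def SimpleGraph.IsEpsRegular {W : Type*} (G : SimpleGraph W) (A B : Finset W) (ε : ℝ) : Prop :=
  ∀ A' ⊆ A, ∀ B' ⊆ B, ε * (A.card : ℝ) ≤ (A'.card : ℝ) → ε * (B.card : ℝ) ≤ (B'.card : ℝ) →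
    |G.pairDensity A B - G.pairDensity A' B'| ≤ ε

/-- A bipartite `U`-coloured graph `(A ∪ B, (P_u)_{u ∈ U})`, with `A` and `B` disjoint subsets of
an ambient set `W`: each `P_u` is a graph between `A` and `B`, and every pair `ab` with `a ∈ A`,
`b ∈ B` is an edge of exactly one `P_u`. -/
structure BipartiteColoredGraph (U W : Type*) where
  A : Finset W
  B : Finset W
  disjoint : Disjoint A B
  color : U → SimpleGraph W
  isBipartiteWith : ∀ u, (color u).IsBipartiteWith (A : Set W) (B : Set W)
  existsUnique_color : ∀ a ∈ A, ∀ b ∈ B, ∃! u, (color u).Adj a b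

/-- `H` is an `(m, Γ)`-blowup of the bigraph `G = (U, V; E)`, where `Γ` is a bipartite
`U`-coloured graph: `H` is a `3`-graph whose vertex set `W` is the disjoint union of `A`, `B` and
sets `C_v`, `v ∈ V`, of size `m ≥ 1`, and for `xy ∈ P_u`, `z ∈ C_v`, the triple `xyz` is an edge
of `H` if `(u, v) ∈ E`, and is not an edge of `H` if `(u, v) ∉ E`. Other triples are arbitrary. -/
def IsBlowup {α β W : Type*} (G : Bigraph α β) (m : ℕ) (Γ : BipartiteColoredGraph G.left W)
    (H : Hypergraph W) : Prop :=
  H.IsThreeGraph ∧ 1 ≤ m ∧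
  ∃ C : G.right → Finset W,
    (∀ v, (C v).card = m) ∧
    (∀ v v', v ≠ v' → Disjoint (C v) (C v')) ∧
    (∀ v, Disjoint Γ.A (C v) ∧ Disjoint Γ.B (C v)) ∧
    (∀ w : W, w ∈ Γ.A ∨ w ∈ Γ.B ∨ ∃ v, w ∈ C v) ∧
    (∀ u : G.left, ∀ v : G.right, (u.1, v.1) ∈ G.edges →
      ∀ x y z, (Γ.color u).Adj x y → z ∈ C v → ({x, y, z} : Set W) ∈ H.edgeSet) ∧
    (∀ u : G.left, ∀ v : G.right, (u.1, v.1) ∉ G.edges →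
      ∀ x y z, (Γ.color u).Adj x y → z ∈ C v → ({x, y, z} : Set W) ∉ H.edgeSet)

end

/-!
Suppose that `ℓ < |U|`, and let `r ≤ 1 / 2` be a lower bound for `1 / |U|` and `1 / |V|`. All error
terms are fixed powers of `r`, which is why polynomially small `ε₁`, `ε₂` suffice.

Over `A × B × C_v`, membership of `xyz` in `H` depends only on the colour of `xy` (and on `v`).
Regularity says that the balanced function `h` of a triad has a small octahedron sum, and
repeated use of the Cauchy–Schwarz inequality (`pow_eight_sum_mul_le_octahedron`) shows that `h`
then has small sum over the triangles with `xy ∈ S` and `z ∈ Z'`, for all `S` and `Z'`. Take for `S` the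
pairs of the cell whose colour puts them in `H`, or those whose colour keeps them out, whichever
makes `|h| ≥ 1 / 2` on the triangles over `S × Z'`, where `Z'` is the intersection of the third part
with `C_v`. As the two bigraphs at the third part are quasirandom and not sparse, a positive
proportion of the triples in `S × Z'` are triangles (`Triad.mul_card_le_sum`), so `S` is small
(`Trigraph.HasDev23.card_le`). Hence for each `v` the relation "the colour of `xy` is a neighbour
of `v`" is nearly constant on every cell that carries a good triple over `A × B × C_v`
(`Decomposition.IsGoodTriple.exists_pattern`).

Nearly all triples are good (`Decomposition.card_badTriples_le`), so one can choose parts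
`V_i`, `V_j` over which nearly all triples are good. Each of the `ℓ` cells between them then has a
pattern on `V`. By irreducibility distinct colours have distinct patterns, so some colour `u`
disagrees with the pattern of every cell (`Bigraph.Irreducible.exists_avoiding`) and is therefore
rare between `V_i ∩ A` and `V_j ∩ B`. This contradicts the `ε`-regularity of `P_u`, whose density is
close to `1 / |U|`.
-/

noncomputable section

/-! ### Cauchy–Schwarz inequalities -/

theorem sq_sum_mul_le_card_mul_sum_sq {ι : Type*} (s : Finset ι) (u f : ι → ℝ)
    (hu : ∀ i ∈ s, |u i| ≤ 1) :
    (∑ i ∈ s, u i * f i) ^ 2 ≤ (s.card : ℝ) * ∑ i ∈ s, f i ^ 2 := by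
  refine (Finset.sum_mul_sq_le_sq_mul_sq s u f).trans ?_
  refine mul_le_mul_of_nonneg_right ?_ (Finset.sum_nonneg fun i _ => sq_nonneg _)
  calc ∑ i ∈ s, u i ^ 2 ≤ ∑ i ∈ s, (1 : ℝ) :=
        Finset.sum_le_sum fun i hi => (sq_le_one_iff_abs_le_one _).2 (hu i hi)
    _ = s.card := by simp

theorem abs_mul_le_one {a b : ℝ} (ha : |a| ≤ 1) (hb : |b| ≤ 1) : |a * b| ≤ 1 := by
  rw [abs_mul]
  exact mul_le_one₀ ha (abs_nonneg b) hb

/-- The sum of a function against a rank-one weight bounded by `1` is controlled by its box norm. -/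
theorem pow_four_sum_mul_le_box {ι κ : Type*} (X : Finset ι) (Y : Finset κ) (f : ι → κ → ℝ)
    (u : ι → ℝ) (v : κ → ℝ) (hu : ∀ x ∈ X, |u x| ≤ 1) (hv : ∀ y ∈ Y, |v y| ≤ 1) :
    (∑ x ∈ X, ∑ y ∈ Y, u x * v y * f x y) ^ 4 ≤
      (X.card : ℝ) ^ 2 * (Y.card : ℝ) ^ 2 * ∑ x₀ ∈ X, ∑ x₁ ∈ X, ∑ y₀ ∈ Y, ∑ y₁ ∈ Y,
        f x₀ y₀ * f x₀ y₁ * f x₁ y₀ * f x₁ y₁ := by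
  have h1 : (∑ x ∈ X, ∑ y ∈ Y, u x * v y * f x y) = ∑ y ∈ Y, v y * ∑ x ∈ X, u x * f x y := by
    rw [Finset.sum_comm]
    refine Finset.sum_congr rfl fun y _ => ?_
    rw [Finset.mul_sum]
    exact Finset.sum_congr rfl fun x _ => by ring
  have h2 : (∑ x ∈ X, ∑ y ∈ Y, u x * v y * f x y) ^ 2 ≤
      (Y.card : ℝ) * ∑ p ∈ X ×ˢ X, (u p.1 * u p.2) * ∑ y ∈ Y, f p.1 y * f p.2 y := by
    rw [h1]
    refine (sq_sum_mul_le_card_mul_sum_sq Y v _ hv).trans (le_of_eq ?_)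
    congr 1
    simp_rw [sq, Finset.sum_mul_sum, Finset.mul_sum, Finset.sum_product]
    rw [Finset.sum_comm]
    refine Finset.sum_congr rfl fun x _ => ?_
    rw [Finset.sum_comm]
    exact Finset.sum_congr rfl fun x' _ => Finset.sum_congr rfl fun y _ => by ring
  have h3 := sq_sum_mul_le_card_mul_sum_sq (X ×ˢ X) (fun p => u p.1 * u p.2)
    (fun p => ∑ y ∈ Y, f p.1 y * f p.2 y) (fun p hp =>
      abs_mul_le_one (hu _ (Finset.mem_product.1 hp).1) (hu _ (Finset.mem_product.1 hp).2))
  have h4 : ∑ p ∈ X ×ˢ X, (∑ y ∈ Y, f p.1 y * f p.2 y) ^ 2 =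
      ∑ x₀ ∈ X, ∑ x₁ ∈ X, ∑ y₀ ∈ Y, ∑ y₁ ∈ Y, f x₀ y₀ * f x₀ y₁ * f x₁ y₀ * f x₁ y₁ := by
    simp_rw [Finset.sum_product, sq, Finset.sum_mul_sum]
    refine Finset.sum_congr rfl fun x _ => Finset.sum_congr rfl fun x' _ =>
      Finset.sum_congr rfl fun y _ => Finset.sum_congr rfl fun y' _ => by ring
  rw [h4, Finset.card_product] at h3
  push_cast at h3
  calc (∑ x ∈ X, ∑ y ∈ Y, u x * v y * f x y) ^ 4
      = ((∑ x ∈ X, ∑ y ∈ Y, u x * v y * f x y) ^ 2) ^ 2 := by ring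
    _ ≤ _ := pow_le_pow_left₀ (sq_nonneg _) h2 2
    _ = (Y.card : ℝ) ^ 2 *
        (∑ p ∈ X ×ˢ X, (u p.1 * u p.2) * ∑ y ∈ Y, f p.1 y * f p.2 y) ^ 2 := by ring
    _ ≤ _ := mul_le_mul_of_nonneg_left h3 (by positivity)
    _ = _ := by ring

/-- The sum of a function of three variables against a weight `f(x, y) g(z)` bounded by `1` is
controlled by the octahedron sum. -/
theorem pow_eight_sum_mul_le_octahedron {ι κ μ : Type*} (X : Finset ι) (Y : Finset κ)
    (Z : Finset μ) (h : ι → κ → μ → ℝ) (f : ι → κ → ℝ) (g : μ → ℝ)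
    (hf : ∀ x ∈ X, ∀ y ∈ Y, |f x y| ≤ 1) (hg : ∀ z ∈ Z, |g z| ≤ 1) :
    (∑ x ∈ X, ∑ y ∈ Y, ∑ z ∈ Z, f x y * g z * h x y z) ^ 8 ≤
      ((X.card : ℝ) * Y.card * Z.card) ^ 6 *
        ∑ x₀ ∈ X, ∑ x₁ ∈ X, ∑ y₀ ∈ Y, ∑ y₁ ∈ Y, ∑ z₀ ∈ Z, ∑ z₁ ∈ Z,
          h x₀ y₀ z₀ * h x₀ y₀ z₁ * h x₀ y₁ z₀ * h x₀ y₁ z₁ *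
          h x₁ y₀ z₀ * h x₁ y₀ z₁ * h x₁ y₁ z₀ * h x₁ y₁ z₁ := by
  set T := ∑ x ∈ X, ∑ y ∈ Y, ∑ z ∈ Z, f x y * g z * h x y z with hT
  set F : μ × μ → ℝ := fun q => ∑ x ∈ X, ∑ y ∈ Y, h x y q.1 * h x y q.2 with hF
  have h1 : T = ∑ p ∈ X ×ˢ Y, f p.1 p.2 * ∑ z ∈ Z, g z * h p.1 p.2 z := by
    rw [hT, Finset.sum_product]
    refine Finset.sum_congr rfl fun x _ => Finset.sum_congr rfl fun y _ => ?_
    rw [Finset.mul_sum]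
    exact Finset.sum_congr rfl fun z _ => by ring
  have h2 : T ^ 2 ≤ ((X.card : ℝ) * Y.card) * ∑ q ∈ Z ×ˢ Z, (g q.1 * g q.2) * F q := by
    rw [h1]
    refine (sq_sum_mul_le_card_mul_sum_sq (X ×ˢ Y) (fun p => f p.1 p.2) _
      fun p hp => hf _ (Finset.mem_product.1 hp).1 _ (Finset.mem_product.1 hp).2).trans
        (le_of_eq ?_)
    rw [Finset.card_product]
    push_cast
    congr 1
    simp_rw [hF, ← Finset.sum_product', sq, Finset.sum_mul_sum, ← Finset.sum_product',
      Finset.mul_sum]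
    rw [Finset.sum_comm, Finset.sum_product]
    exact Finset.sum_congr rfl fun p _ => Finset.sum_congr rfl fun q _ => by ring
  have h3 : (∑ q ∈ Z ×ˢ Z, (g q.1 * g q.2) * F q) ^ 2 ≤
      (Z.card : ℝ) ^ 2 * ∑ q ∈ Z ×ˢ Z, F q ^ 2 := by
    refine (sq_sum_mul_le_card_mul_sum_sq (Z ×ˢ Z) (fun q => g q.1 * g q.2) F fun p hp =>
      abs_mul_le_one (hg _ (Finset.mem_product.1 hp).1) (hg _ (Finset.mem_product.1 hp).2)).trans
        (le_of_eq ?_)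
    rw [Finset.card_product]
    push_cast
    ring
  have h4 : (∑ q ∈ Z ×ˢ Z, F q ^ 2) ^ 2 ≤ (Z.card : ℝ) ^ 2 * ∑ q ∈ Z ×ˢ Z, F q ^ 4 := by
    have := sq_sum_mul_le_card_mul_sum_sq (Z ×ˢ Z) (fun _ => 1) (fun q => F q ^ 2) (by simp)
    rw [Finset.card_product] at this
    push_cast at this
    simp only [one_mul, ← pow_mul] at this
    calc _ ≤ _ := this
      _ = _ := by ring
  have h5 : ∑ q ∈ Z ×ˢ Z, F q ^ 4 ≤ (X.card : ℝ) ^ 2 * (Y.card : ℝ) ^ 2 *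
      ∑ x₀ ∈ X, ∑ x₁ ∈ X, ∑ y₀ ∈ Y, ∑ y₁ ∈ Y, ∑ z₀ ∈ Z, ∑ z₁ ∈ Z,
          h x₀ y₀ z₀ * h x₀ y₀ z₁ * h x₀ y₁ z₀ * h x₀ y₁ z₁ *
          h x₁ y₀ z₀ * h x₁ y₀ z₁ * h x₁ y₁ z₀ * h x₁ y₁ z₁ := by
    have : ∀ q ∈ Z ×ˢ Z, F q ^ 4 ≤ (X.card : ℝ) ^ 2 * (Y.card : ℝ) ^ 2 *
        ∑ x₀ ∈ X, ∑ x₁ ∈ X, ∑ y₀ ∈ Y, ∑ y₁ ∈ Y,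
          (h x₀ y₀ q.1 * h x₀ y₀ q.2) * (h x₀ y₁ q.1 * h x₀ y₁ q.2) *
          (h x₁ y₀ q.1 * h x₁ y₀ q.2) * (h x₁ y₁ q.1 * h x₁ y₁ q.2) := by
      intro q _
      simpa using pow_four_sum_mul_le_box X Y (fun x y => h x y q.1 * h x y q.2)
        (fun _ => 1) (fun _ => 1) (by simp) (by simp)
    refine (Finset.sum_le_sum this).trans (le_of_eq ?_)
    rw [← Finset.mul_sum, Finset.sum_comm]
    congr 1
    refine Finset.sum_congr rfl fun x _ => ?_
    rw [Finset.sum_comm]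
    refine Finset.sum_congr rfl fun x' _ => ?_
    rw [Finset.sum_comm]
    refine Finset.sum_congr rfl fun y _ => ?_
    rw [Finset.sum_comm]
    refine Finset.sum_congr rfl fun y' _ => ?_
    rw [Finset.sum_product]
    exact Finset.sum_congr rfl fun z _ => Finset.sum_congr rfl fun z' _ => by ring
  set O := ∑ x₀ ∈ X, ∑ x₁ ∈ X, ∑ y₀ ∈ Y, ∑ y₁ ∈ Y, ∑ z₀ ∈ Z, ∑ z₁ ∈ Z,
          h x₀ y₀ z₀ * h x₀ y₀ z₁ * h x₀ y₁ z₀ * h x₀ y₁ z₁ *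
          h x₁ y₀ z₀ * h x₁ y₀ z₁ * h x₁ y₁ z₀ * h x₁ y₁ z₁
  set S := ∑ q ∈ Z ×ˢ Z, (g q.1 * g q.2) * F q
  calc T ^ 8 = (T ^ 2) ^ 4 := by ring
    _ ≤ (((X.card : ℝ) * Y.card) * S) ^ 4 := pow_le_pow_left₀ (sq_nonneg _) h2 4
    _ = ((X.card : ℝ) * Y.card) ^ 4 * (S ^ 2) ^ 2 := by ring
    _ ≤ ((X.card : ℝ) * Y.card) ^ 4 * ((Z.card : ℝ) ^ 2 * ∑ q ∈ Z ×ˢ Z, F q ^ 2) ^ 2 := by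
      gcongr
    _ = ((X.card : ℝ) * Y.card * Z.card) ^ 4 * (∑ q ∈ Z ×ˢ Z, F q ^ 2) ^ 2 := by ring
    _ ≤ ((X.card : ℝ) * Y.card * Z.card) ^ 4 * ((Z.card : ℝ) ^ 2 *
          ((X.card : ℝ) ^ 2 * (Y.card : ℝ) ^ 2 * O)) := by
      refine mul_le_mul_of_nonneg_left (h4.trans ?_) (by positivity)
      exact mul_le_mul_of_nonneg_left h5 (by positivity)
    _ = _ := by ring

/-! ### Counting in quasirandom bigraphs and triads -/

namespace Bigraph

variable {α β γ : Type*}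

theorem density_nonneg (G : Bigraph α β) : 0 ≤ G.density := by
  unfold density; positivity

theorem density_le_one (G : Bigraph α β) : G.density ≤ 1 := by
  refine div_le_one_of_le₀ ?_ (by positivity)
  have := Finset.card_le_card G.edges_subset
  rw [Finset.card_product] at this
  exact_mod_cast this

open Classical in
/-- The indicator function of the edges is the density plus the balanced function. -/
theorem ite_mem_edges_eq (G : Bigraph α β) (x : α) (y : β) :
    (if (x, y) ∈ G.edges then (1 : ℝ) else 0) = G.density + G.balanced x y := by
  unfold balanced
  split_ifs <;> ring

/-- A bigraph with `dev₂(θ⁴, d)` is uniform against rank-one weights bounded by `1`. -/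
theorem HasDev2.abs_sum_le {G : Bigraph α β} {θ d : ℝ} (hG : G.HasDev2 (θ ^ 4) d) (hθ : 0 ≤ θ)
    (u : α → ℝ) (v : β → ℝ) (hu : ∀ x ∈ G.left, |u x| ≤ 1) (hv : ∀ y ∈ G.right, |v y| ≤ 1) :
    |∑ x ∈ G.left, ∑ y ∈ G.right, u x * v y * G.balanced x y| ≤
      θ * G.left.card * G.right.card := by
  refine abs_le_of_sq_le_sq ?_ (by positivity)
  refine (pow_le_pow_iff_left₀ (sq_nonneg _) (sq_nonneg _) two_ne_zero).1 ?_
  calc _ = (∑ x ∈ G.left, ∑ y ∈ G.right, u x * v y * G.balanced x y) ^ 4 := by ring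
    _ ≤ _ := pow_four_sum_mul_le_box _ _ _ u v hu hv
    _ ≤ (G.left.card : ℝ) ^ 2 * (G.right.card : ℝ) ^ 2 *
        (θ ^ 4 * (G.left.card : ℝ) ^ 2 * (G.right.card : ℝ) ^ 2) :=
      mul_le_mul_of_nonneg_left hG.2 (by positivity)
    _ = _ := by ring

end Bigraph

open Classical in
/-- If two of the three bigraphs of a triad are quasirandom, then any set `S` of pairs in the
third one extends to the expected number of triangles with apex in a given set `Z'`. -/
theorem Triad.mul_card_le_sum {W : Type*} (T : Triad W) {θ d d' : ℝ} (hθ : 0 ≤ θ)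
    (hXZ : T.bigraphXZ.HasDev2 (θ ^ 4) d) (hYZ : T.bigraphYZ.HasDev2 (θ ^ 4) d')
    {S : Finset (W × W)} (hS : S ⊆ T.X ×ˢ T.Y) {Z' : Finset W} (hZ : Z' ⊆ T.Z) :
    T.bigraphXZ.density * T.bigraphYZ.density * (S.card * Z'.card) -
        2 * θ * T.X.card * T.Y.card * T.Z.card ≤
      ∑ x ∈ T.X, ∑ y ∈ T.Y, ∑ z ∈ T.Z, (if (x, y) ∈ S then (1 : ℝ) else 0) *
        (if z ∈ Z' then (1 : ℝ) else 0) * ((if (x, z) ∈ T.edgesXZ then (1 : ℝ) else 0) *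
        (if (y, z) ∈ T.edgesYZ then (1 : ℝ) else 0)) := by
  set s : W → W → ℝ := fun x y => if (x, y) ∈ S then (1 : ℝ) else 0 with hs
  set w : W → ℝ := fun z => if z ∈ Z' then (1 : ℝ) else 0 with hw
  set e : W → W → ℝ := fun y z => if (y, z) ∈ T.edgesYZ then (1 : ℝ) else 0 with he
  set p := T.bigraphXZ.density
  set q := T.bigraphYZ.density with hq
  have hs1 : ∀ x y, |s x y| ≤ 1 := fun x y => by simp only [hs]; split_ifs <;> simp
  have hw1 : ∀ z, |w z| ≤ 1 := fun z => by simp only [hw]; split_ifs <;> simp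
  have he1 : ∀ y z, |e y z| ≤ 1 := fun y z => by simp only [he]; split_ifs <;> simp
  have hsum : ∑ x ∈ T.X, ∑ y ∈ T.Y, ∑ z ∈ T.Z, s x y * w z = S.card * Z'.card := by
    have h1 : ∑ z ∈ T.Z, w z = Z'.card := by
      rw [Finset.sum_boole]
      congr 2
      ext z
      simpa using fun hz => hZ hz
    have h2 : ∑ x ∈ T.X, ∑ y ∈ T.Y, s x y = S.card := by
      rw [← Finset.sum_product' (f := s), Finset.sum_boole]
      congr 2
      ext z
      simpa using fun hz => Finset.mem_product.1 (hS hz)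
    rw [← h1, ← h2, Finset.sum_mul]
    refine Finset.sum_congr rfl fun x _ => ?_
    rw [Finset.sum_mul]
    exact Finset.sum_congr rfl fun y _ => by rw [Finset.mul_sum]
  have hexp : ∀ x y z, s x y * w z * ((if (x, z) ∈ T.edgesXZ then (1 : ℝ) else 0) * e y z) =
      p * q * (s x y * w z) + p * (s x y * w z * T.bigraphYZ.balanced y z) +
        s x y * (w z * e y z) * T.bigraphXZ.balanced x z := by
    intro x y z
    have h1 := T.bigraphXZ.ite_mem_edges_eq x z
    have h2 := T.bigraphYZ.ite_mem_edges_eq y z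
    change (if (x, z) ∈ T.edgesXZ then (1 : ℝ) else 0) = _ at h1
    change e y z = _ at h2
    rw [h1]
    linear_combination p * s x y * w z * h2
  have hB : |∑ x ∈ T.X, ∑ y ∈ T.Y, ∑ z ∈ T.Z, s x y * w z * T.bigraphYZ.balanced y z| ≤
      θ * T.X.card * T.Y.card * T.Z.card := by
    refine (Finset.abs_sum_le_sum_abs _ _).trans ?_
    calc _ ≤ ∑ x ∈ T.X, θ * T.Y.card * T.Z.card := Finset.sum_le_sum fun x _ =>
          hYZ.abs_sum_le hθ (s x) w (fun y _ => hs1 x y) (fun z _ => hw1 z)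
      _ = _ := by rw [Finset.sum_const, nsmul_eq_mul]; ring
  have hC : |∑ x ∈ T.X, ∑ y ∈ T.Y, ∑ z ∈ T.Z, s x y * (w z * e y z) *
      T.bigraphXZ.balanced x z| ≤ θ * T.X.card * T.Y.card * T.Z.card := by
    rw [Finset.sum_comm]
    refine (Finset.abs_sum_le_sum_abs _ _).trans ?_
    calc _ ≤ ∑ y ∈ T.Y, θ * T.X.card * T.Z.card := Finset.sum_le_sum fun y _ =>
          hXZ.abs_sum_le hθ (fun x => s x y) (fun z => w z * e y z) (fun x _ => hs1 x y)
            (fun z _ => abs_mul_le_one (hw1 z) (he1 y z))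
      _ = _ := by rw [Finset.sum_const, nsmul_eq_mul]; ring
  have hp : |p| ≤ 1 := by
    rw [abs_of_nonneg T.bigraphXZ.density_nonneg]; exact T.bigraphXZ.density_le_one
  have hpB := (abs_mul p _).le.trans (mul_le_mul hp hB (abs_nonneg _) zero_le_one)
  change _ ≤ ∑ x ∈ T.X, ∑ y ∈ T.Y, ∑ z ∈ T.Z, s x y * w z *
    ((if (x, z) ∈ T.edgesXZ then (1 : ℝ) else 0) * e y z)
  have hG : ∑ x ∈ T.X, ∑ y ∈ T.Y, ∑ z ∈ T.Z, s x y * w z *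
      ((if (x, z) ∈ T.edgesXZ then (1 : ℝ) else 0) * e y z) =
      p * q * (S.card * Z'.card) +
      p * (∑ x ∈ T.X, ∑ y ∈ T.Y, ∑ z ∈ T.Z, s x y * w z * T.bigraphYZ.balanced y z) +
      ∑ x ∈ T.X, ∑ y ∈ T.Y, ∑ z ∈ T.Z, s x y * (w z * e y z) * T.bigraphXZ.balanced x z := by
    rw [← hsum]
    simp only [hexp, Finset.sum_add_distrib, Finset.mul_sum]
  rw [hG]
  linarith [(abs_le.1 hpB).1, (abs_le.1 hC).1]

open Classical in
/-- In a regular triad whose bigraphs over `Z` are not too sparse, a set `S` of edges over which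
the balanced function takes one constant value, not close to `0`, on all triangles with apex in a
large set `Z'`, is small. -/
theorem Trigraph.HasDev23.card_le {W : Type*} {H : Trigraph W} {T : Triad W} {η θ δ₁ δ₂ c : ℝ}
    (hT : H.HasDev23 T δ₁ δ₂) (hη : 0 < η) (hθ : 0 ≤ θ) (hθ1 : θ ≤ 1)
    (h₁ : δ₁ ≤ θ ^ 8) (h₂ : δ₂ ≤ θ ^ 8)
    (hXZ : η ≤ T.bigraphXZ.density) (hYZ : η ≤ T.bigraphYZ.density)
    {Z' : Finset W} (hZ : Z' ⊆ T.Z) (hZc : η * T.Z.card ≤ Z'.card) (hne : T.Z.Nonempty)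
    {S : Finset (W × W)} (hS : S ⊆ T.edgesXY) (hc : 1 / 2 ≤ |c|)
    (hSc : ∀ x y z, (x, y) ∈ S → z ∈ Z' → (x, y, z) ∈ T.triangles → H.relBalanced T x y z = c) :
    η ^ 3 * S.card ≤ 8 * θ * (T.X.card * T.Y.card) := by
  obtain ⟨d, d', d'', hd, hd', hd'', hXY, hXZ', hYZ', hoct⟩ := hT
  have h8 : θ ^ 8 ≤ θ ^ 4 := pow_le_pow_of_le_one hθ hθ1 (by norm_num)
  have h81 : θ ^ 8 ≤ 1 := pow_le_one₀ hθ hθ1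
  have hmono : ∀ {G : Bigraph W W} {e : ℝ}, G.HasDev2 δ₂ e → G.HasDev2 (θ ^ 4) e := by
    intro G e hG
    refine ⟨hG.1.trans (h₂.trans h8), hG.2.trans ?_⟩
    gcongr
    exact h₂.trans h8
  have hle2 : ∀ {G : Bigraph W W} {e : ℝ}, G.HasDev2 δ₂ e → e ≤ 2 := by
    intro G e hG
    have := (abs_le.1 hG.1).1
    linarith [G.density_le_one]
  have hcount := T.mul_card_le_sum hθ (hmono hXZ') (hmono hYZ')
    (hS.trans T.edgesXY_subset) hZ
  set N := ∑ x ∈ T.X, ∑ y ∈ T.Y, ∑ z ∈ T.Z, (if (x, y) ∈ S then (1 : ℝ) else 0) *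
        (if z ∈ Z' then (1 : ℝ) else 0) * ((if (x, z) ∈ T.edgesXZ then (1 : ℝ) else 0) *
        (if (y, z) ∈ T.edgesYZ then (1 : ℝ) else 0)) with hN
  set M : ℝ := (T.X.card : ℝ) * T.Y.card * T.Z.card with hM
  have hM0 : 0 ≤ M := by positivity
  have hN0 : 0 ≤ N := by
    refine Finset.sum_nonneg fun x _ => Finset.sum_nonneg fun y _ => Finset.sum_nonneg fun z _ => ?_
    positivity
  have hcN : c * N = ∑ x ∈ T.X, ∑ y ∈ T.Y, ∑ z ∈ T.Z, (if (x, y) ∈ S then (1 : ℝ) else 0) *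
        (if z ∈ Z' then (1 : ℝ) else 0) * H.relBalanced T x y z := by
    simp only [hN, Finset.mul_sum]
    refine Finset.sum_congr rfl fun x hx => Finset.sum_congr rfl fun y hy =>
      Finset.sum_congr rfl fun z hz => ?_
    by_cases h1 : (x, y) ∈ S
    · by_cases h2 : z ∈ Z'
      · by_cases h3 : (x, y, z) ∈ T.triangles
        · rw [hSc x y z h1 h2 h3]
          have := (Finset.mem_filter.1 h3).2
          simp [h1, h2, this.2.1, this.2.2]
        · have h4 : ¬ ((y, z) ∈ T.edgesYZ ∧ (x, z) ∈ T.edgesXZ) := fun h => h3 <| by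
            simp [Triad.triangles, hx, hy, hz, hS h1, h.1, h.2]
          have h5 : H.relBalanced T x y z = 0 := by simp [Trigraph.relBalanced, h3]
          rw [h5]
          by_cases h6 : (y, z) ∈ T.edgesYZ
          · have : (x, z) ∉ T.edgesXZ := fun h => h4 ⟨h6, h⟩
            simp [this]
          · simp [h6]
      · simp [h2]
    · simp [h1]
  have hpow : (c * N) ^ 8 ≤ (3 * θ * M) ^ 8 := by
    rw [hcN]
    refine (pow_eight_sum_mul_le_octahedron T.X T.Y T.Z (H.relBalanced T)
      (fun x y => if (x, y) ∈ S then (1 : ℝ) else 0) (fun z => if z ∈ Z' then (1 : ℝ) else 0)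
      (fun x _ y _ => by split_ifs <;> simp) (fun z _ => by split_ifs <;> simp)).trans ?_
    refine (mul_le_mul_of_nonneg_left hoct (by positivity)).trans ?_
    calc M ^ 6 * (δ₁ * d ^ 4 * d' ^ 4 * d'' ^ 4 * (T.X.card : ℝ) ^ 2 * (T.Y.card : ℝ) ^ 2 *
          (T.Z.card : ℝ) ^ 2) ≤ M ^ 6 * (θ ^ 8 * 2 ^ 4 * 2 ^ 4 * 2 ^ 4 * (T.X.card : ℝ) ^ 2 *
          (T.Y.card : ℝ) ^ 2 * (T.Z.card : ℝ) ^ 2) := by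
          gcongr
          exacts [hle2 hXY, hle2 hYZ', hle2 hXZ']
      _ = 4096 * (θ * M) ^ 8 := by rw [hM]; ring
      _ ≤ 6561 * (θ * M) ^ 8 := by gcongr; norm_num
      _ = _ := by ring
  clear_value N M
  clear hoct hN hcN
  have hcN3 : |c| * N ≤ 3 * θ * M := by
    have h : |c * N| ≤ 3 * θ * M := by
      have h8 : (8 : ℕ) ≠ 0 := by norm_num
      refine (pow_le_pow_iff_left₀ (abs_nonneg _) (by positivity) h8).1 ?_
      rwa [Even.pow_abs ⟨4, rfl⟩]
    rwa [abs_mul, abs_of_nonneg hN0] at h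
  have hN6 : N ≤ 6 * θ * M := by
    have := mul_le_mul_of_nonneg_right hc hN0
    linarith only [this, hcN3]
  have hdd : η ^ 2 * (S.card * (η * T.Z.card)) ≤
      T.bigraphXZ.density * T.bigraphYZ.density * (S.card * Z'.card) := by
    rw [sq]
    have := hη.le.trans hXZ
    have := mul_nonneg this T.bigraphYZ.density_nonneg
    gcongr
  have hZ0 : (0 : ℝ) < T.Z.card := by exact_mod_cast hne.card_pos
  have : (η ^ 3 * S.card) * T.Z.card ≤ (8 * θ * (T.X.card * T.Y.card)) * T.Z.card := by
    have e : 2 * θ * T.X.card * T.Y.card * T.Z.card = 2 * θ * M := by rw [hM]; ring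
    rw [e] at hcount
    calc _ = η ^ 2 * (S.card * (η * T.Z.card)) := by ring
      _ ≤ 8 * θ * M := by linarith only [hdd, hcount, hN6]
      _ = _ := by rw [hM]; ring
  exact le_of_mul_le_mul_right this hZ0

/-! ### Exceptional triples of a decomposition -/

namespace Decomposition

variable {W : Type*} {t ℓ : ℕ}

theorem part_injective_of_mem (P : Decomposition W t ℓ) {x : W} {i j : Fin t}
    (hi : x ∈ P.part i) (hj : x ∈ P.part j) : i = j :=
  (P.existsUnique_part x).unique hi hj

theorem sum_card_part [Fintype W] (P : Decomposition W t ℓ) :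
    ∑ i, ((P.part i).card : ℝ) = Fintype.card W := by
  classical
  have h : (Finset.univ : Finset (Fin t)).biUnion P.part = Finset.univ := by
    ext x
    simpa using (P.existsUnique_part x).exists
  rw [← Finset.card_univ, ← h, Finset.card_biUnion]
  · push_cast; rfl
  · intro i _ j _ hij
    exact Finset.disjoint_left.2 fun x hi hj => hij (P.part_injective_of_mem hi hj)

open Classical in
/-- The points of `A` lying in parts that meet `A` in a proportion less than `η`. -/
def sparsePoints (P : Decomposition W t ℓ) (A : Finset W) (η : ℝ) : Finset W :=
  Finset.univ.biUnion fun i =>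
    if ((P.part i ∩ A).card : ℝ) < η * (P.part i).card then P.part i ∩ A else ∅

open Classical in
/-- The points of `A` lying in parts that meet `A` in fewer than `μ` points. -/
def fewPoints (P : Decomposition W t ℓ) (A : Finset W) (μ : ℝ) : Finset W :=
  Finset.univ.biUnion fun i => if ((P.part i ∩ A).card : ℝ) < μ then P.part i ∩ A else ∅

open Classical in
/-- The pairs lying in cells of density less than `η`. -/
def sparsePairs (P : Decomposition W t ℓ) (η : ℝ) : Finset (W × W) :=
  Finset.univ.biUnion fun q : Fin t × Fin t × Fin ℓ =>
    if (P.bigraph q.1 q.2.1 q.2.2).density < η then P.cell q.1 q.2.1 q.2.2 else ∅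

theorem card_sparsePoints_le [Fintype W] (P : Decomposition W t ℓ) (A : Finset W) {η : ℝ}
    (hη : 0 ≤ η) : ((P.sparsePoints A η).card : ℝ) ≤ η * Fintype.card W := by
  classical
  rw [← P.sum_card_part, Finset.mul_sum]
  refine (Nat.cast_le.2 Finset.card_biUnion_le).trans ?_
  push_cast
  refine Finset.sum_le_sum fun i _ => ?_
  split_ifs with h
  · exact h.le
  · simpa using by positivity

theorem card_fewPoints_le (P : Decomposition W t ℓ) (A : Finset W) {μ : ℝ}
    (hμ : 0 ≤ μ) : ((P.fewPoints A μ).card : ℝ) ≤ t * μ := by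
  classical
  have : (t : ℝ) * μ = ∑ _i : Fin t, μ := by simp
  rw [this]
  refine (Nat.cast_le.2 Finset.card_biUnion_le).trans ?_
  push_cast
  refine Finset.sum_le_sum fun i _ => ?_
  split_ifs with h
  · exact h.le
  · simpa using hμ

theorem card_sparsePairs_le [Fintype W] (P : Decomposition W t ℓ) {η : ℝ} (hη : 0 ≤ η) :
    ((P.sparsePairs η).card : ℝ) ≤ ℓ * η * (Fintype.card W : ℝ) ^ 2 := by
  classical
  have hW : ℓ * η * (Fintype.card W : ℝ) ^ 2 =
      ∑ q : Fin t × Fin t × Fin ℓ, η * ((P.part q.1).card * (P.part q.2.1).card) := by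
    simp_rw [Fintype.sum_prod_type, ← Finset.mul_sum, sq, ← P.sum_card_part, Finset.sum_mul_sum]
    simp only [Finset.sum_const, Finset.card_univ, Fintype.card_fin, nsmul_eq_mul,
      ← Finset.mul_sum, ← Finset.sum_mul]
    ring
  rw [hW]
  refine (Nat.cast_le.2 Finset.card_biUnion_le).trans ?_
  push_cast
  refine Finset.sum_le_sum fun q _ => ?_
  split_ifs with h
  · have hsub := Finset.card_le_card (P.cell_subset q.1 q.2.1 q.2.2)
    rw [Finset.card_product] at hsub
    rcases Nat.eq_zero_or_pos ((P.part q.1).card * (P.part q.2.1).card) with h0 | h0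
    · rw [h0] at hsub
      rw [Nat.le_zero.1 hsub]
      simpa using by positivity
    · have h0' : (0 : ℝ) < (P.part q.1).card * (P.part q.2.1).card := by exact_mod_cast h0
      exact ((div_lt_iff₀ h0').1 h).le
  · simpa using by positivity

open Classical in
/-- A triple that is a triangle of a regular triad of `P` in which all the relevant quantities are
bounded below: the first part has a proportion at least `η`, and at least `μ` points, in `A`, the
second one in `B`, the third one has a proportion at least `η` in `C`, and the two bigraphs at the
third part have density at least `η`. -/
def IsGoodTriple (P : Decomposition W t ℓ) (H : Trigraph W) (A B C : Finset W)
    (η μ δ₁ δ₂ : ℝ) (p : W × W × W) : Prop :=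
  ∃ i j k a b c, p ∈ (P.triad i j k a b c).triangles ∧
    (H.restrict (P.triad i j k a b c)).HasDev23 (P.triad i j k a b c) δ₁ δ₂ ∧
    η * (P.part i).card ≤ (P.part i ∩ A).card ∧ η * (P.part j).card ≤ (P.part j ∩ B).card ∧
    η * (P.part k).card ≤ (P.part k ∩ C).card ∧
    μ ≤ (P.part i ∩ A).card ∧ μ ≤ (P.part j ∩ B).card ∧
    η ≤ (P.bigraph i k b).density ∧ η ≤ (P.bigraph j k c).density

open Classical in
/-- The triples in `A × B × C` that are not good. -/
def badTriples (P : Decomposition W t ℓ) (H : Trigraph W) (A B C : Finset W)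
    (η μ δ₁ δ₂ : ℝ) : Finset (W × W × W) :=
  (A ×ˢ B ×ˢ C).filter fun p => ¬ P.IsGoodTriple H A B C η μ δ₁ δ₂ p

theorem card_badTriples_le [Fintype W] (P : Decomposition W t ℓ) (H : Hypergraph W)
    (A B C : Finset W) {η μ δ₁ δ₂ : ℝ} (hη : 0 ≤ η) (hμ : 0 ≤ μ) (hP : P.IsRegular H δ₁ δ₂) :
    ((P.badTriples H.toTrigraph A B C η μ δ₁ δ₂).card : ℝ) ≤
      (δ₁ + (3 + 2 * ℓ) * η) * (Fintype.card W : ℝ) ^ 3 +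
        2 * t * μ * (Fintype.card W : ℝ) ^ 2 := by
  classical
  have hR := hP.2
  set N : ℝ := (Fintype.card W : ℝ) with hN
  set R := Finset.univ.filter fun p : W × W × W =>
      ¬ ∃ i j k a b c, p ∈ (P.triad i j k a b c).triangles ∧
        (H.toTrigraph.restrict (P.triad i j k a b c)).HasDev23 (P.triad i j k a b c) δ₁ δ₂
  set X := P.sparsePoints A η ∪ P.fewPoints A μ
  set Y := P.sparsePoints B η ∪ P.fewPoints B μ
  set Z := P.sparsePoints C η
  set D := P.sparsePairs η
  have hX : (X.card : ℝ) ≤ η * N + t * μ := by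
    have := (Nat.cast_le (α := ℝ)).2 (Finset.card_union_le (P.sparsePoints A η) (P.fewPoints A μ))
    push_cast at this
    linarith [P.card_sparsePoints_le A hη, P.card_fewPoints_le A hμ]
  have hY : (Y.card : ℝ) ≤ η * N + t * μ := by
    have := (Nat.cast_le (α := ℝ)).2 (Finset.card_union_le (P.sparsePoints B η) (P.fewPoints B μ))
    push_cast at this
    linarith [P.card_sparsePoints_le B hη, P.card_fewPoints_le B hμ]
  have hZ : (Z.card : ℝ) ≤ η * N := P.card_sparsePoints_le C hη
  have hD : (D.card : ℝ) ≤ ℓ * η * N ^ 2 := P.card_sparsePairs_le hη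
  have hsub : P.badTriples H.toTrigraph A B C η μ δ₁ δ₂ ⊆
      R ∪ (X ×ˢ Finset.univ ∪ Finset.univ ×ˢ Y ×ˢ Finset.univ ∪
        Finset.univ ×ˢ Finset.univ ×ˢ Z ∪ Finset.univ ×ˢ D ∪
        (D ×ˢ Finset.univ).image fun q => (q.1.1, q.2, q.1.2)) := by
    rintro ⟨x, y, z⟩ hp
    obtain ⟨hmem, hbad⟩ := Finset.mem_filter.1 hp
    obtain ⟨hxA, hyB, hzC⟩ : x ∈ A ∧ y ∈ B ∧ z ∈ C := by simpa using hmem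
    by_contra hcon
    simp only [Finset.mem_union, not_or] at hcon
    obtain ⟨hR', ⟨⟨⟨hx, hy⟩, hz⟩, hyz⟩, hxz⟩ := hcon
    simp only [R, Finset.mem_filter, Finset.mem_univ, true_and, not_not] at hR'
    obtain ⟨i, j, k, a, b, c, htri, hdev⟩ := hR'
    refine hbad ⟨i, j, k, a, b, c, htri, hdev, ?_⟩
    obtain ⟨hV, hc1, hc2, hc3⟩ : (x ∈ P.part i ∧ y ∈ P.part j ∧ z ∈ P.part k) ∧
        (x, y) ∈ P.cell i j a ∧ (y, z) ∈ P.cell j k c ∧ (x, z) ∈ P.cell i k b := by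
      simpa [Triad.triangles, Decomposition.triad] using htri
    have hx' : x ∉ X := fun h => hx (by simp [h])
    have hy' : y ∉ Y := fun h => hy (by simp [h])
    have hz' : z ∉ Z := fun h => hz (by simp [h])
    have hyz' : (y, z) ∉ D := fun h => hyz (by simp [h])
    have hxz' : (x, z) ∉ D := fun h => hxz (Finset.mem_image.2 ⟨((x, z), y), by simp [h], rfl⟩)
    simp only [X, Y, Finset.mem_union, not_or] at hx' hy'
    refine ⟨?_, ?_, ?_, ?_, ?_, ?_, ?_⟩ <;> by_contra! hlt
    · exact hx'.1 (Finset.mem_biUnion.2 ⟨i, Finset.mem_univ _, by simp [hlt, hV.1, hxA]⟩)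
    · exact hy'.1 (Finset.mem_biUnion.2 ⟨j, Finset.mem_univ _, by simp [hlt, hV.2.1, hyB]⟩)
    · exact hz' (Finset.mem_biUnion.2 ⟨k, Finset.mem_univ _, by simp [hlt, hV.2.2, hzC]⟩)
    · exact hx'.2 (Finset.mem_biUnion.2 ⟨i, Finset.mem_univ _, by simp [hlt, hV.1, hxA]⟩)
    · exact hy'.2 (Finset.mem_biUnion.2 ⟨j, Finset.mem_univ _, by simp [hlt, hV.2.1, hyB]⟩)
    · exact hxz' (Finset.mem_biUnion.2 ⟨(i, k, b), Finset.mem_univ _, by simp [hlt, hc3]⟩)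
    · exact hyz' (Finset.mem_biUnion.2 ⟨(j, k, c), Finset.mem_univ _, by simp [hlt, hc2]⟩)
  have hcard : (P.badTriples H.toTrigraph A B C η μ δ₁ δ₂).card ≤
      R.card + (X.card * (Fintype.card W * Fintype.card W) +
        Fintype.card W * (Y.card * Fintype.card W) +
        Fintype.card W * (Fintype.card W * Z.card) + Fintype.card W * D.card +
        D.card * Fintype.card W) := by
    refine (Finset.card_le_card hsub).trans ?_
    refine (Finset.card_union_le _ _).trans (Nat.add_le_add_left ?_ _)
    refine (Finset.card_union_le _ _).trans (Nat.add_le_add ?_ ?_)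
    · refine (Finset.card_union_le _ _).trans (Nat.add_le_add ?_ ?_)
      · refine (Finset.card_union_le _ _).trans (Nat.add_le_add ?_ ?_)
        · refine (Finset.card_union_le _ _).trans (Nat.add_le_add ?_ ?_) <;>
            simp [Finset.card_product]
        · simp [Finset.card_product]
      · simp [Finset.card_product]
    · refine Finset.card_image_le.trans ?_
      simp [Finset.card_product]
  have hcard' := (Nat.cast_le (α := ℝ)).2 hcard
  push_cast at hcard'
  rw [← hN] at hcard'
  have hN0 : 0 ≤ N := by positivity
  calc _ ≤ _ := hcard'
    _ ≤ δ₁ * N ^ 3 + ((η * N + t * μ) * (N * N) + N * ((η * N + t * μ) * N) + N * (N * (η * N)) +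
        N * (ℓ * η * N ^ 2) + ℓ * η * N ^ 2 * N) := by gcongr
    _ = _ := by ring

end Decomposition

/-! ### Patterns on cells and colours -/

namespace Decomposition

variable {W : Type*} {t ℓ : ℕ}

open Classical in
theorem sum_card_filter_part (P : Decomposition W t ℓ) {σ : Type*} (S : Finset σ) (f : σ → W) :
    ∑ i, (S.filter fun s => f s ∈ P.part i).card = S.card := by
  choose idx hidx huniq using P.existsUnique_part
  have h : ∀ x i, x ∈ P.part i ↔ idx x = i :=
    fun x i => ⟨fun hx => (huniq x i hx).symm, fun hx => hx ▸ hidx x⟩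
  simp only [h]
  exact (Finset.card_eq_sum_card_fiberwise fun s _ => Finset.mem_coe.2 (Finset.mem_univ _)).symm

open Classical in
/-- The triples of `S` whose first two coordinates lie in `V_i × V_j`. -/
def triplesOver (P : Decomposition W t ℓ) (i j : Fin t) (S : Finset (W × W × W)) :
    Finset (W × W × W) :=
  S.filter fun p => p.1 ∈ P.part i ∧ p.2.1 ∈ P.part j

open Classical in
/-- If there are few exceptional triples over `A × B`, then there are proportionally few of them
over `(V_i ∩ A) × (V_j ∩ B)` for some parts `V_i`, `V_j`. -/
theorem exists_parts_sum_card_lt (P : Decomposition W t ℓ) (A B : Finset W) {ι : Type*}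
    [Fintype ι] (bad : ι → Finset (W × W × W)) {κ : ℝ}
    (h : ∑ v, ((bad v).card : ℝ) < κ * (A.card * B.card)) :
    ∃ i j, ∑ v, ((P.triplesOver i j (bad v)).card : ℝ) <
      κ * ((P.part i ∩ A).card * (P.part j ∩ B).card) := by
  have hA : ∀ A : Finset W, (A.card : ℝ) = ∑ i, ((P.part i ∩ A).card : ℝ) := fun A => by
    rw [← P.sum_card_filter_part A id]
    push_cast
    refine Finset.sum_congr rfl fun i _ => ?_
    congr 2
    ext x
    simp [and_comm]
  have hbad : ∀ v, ((bad v).card : ℝ) = ∑ q : Fin t × Fin t,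
      ((P.triplesOver q.1 q.2 (bad v)).card : ℝ) := fun v => by
    rw [Fintype.sum_prod_type, ← P.sum_card_filter_part (bad v) (fun p => p.1)]
    push_cast
    refine Finset.sum_congr rfl fun i _ => ?_
    rw [← P.sum_card_filter_part _ (fun p : W × W × W => p.2.1)]
    push_cast
    exact Finset.sum_congr rfl fun j _ => by rw [Finset.filter_filter, triplesOver]
  have h' : ∑ q : Fin t × Fin t, ∑ v,
      ((P.triplesOver q.1 q.2 (bad v)).card : ℝ) <
      ∑ q : Fin t × Fin t, κ * ((P.part q.1 ∩ A).card * (P.part q.2 ∩ B).card) := by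
    rw [Finset.sum_comm, ← Finset.mul_sum, Fintype.sum_prod_type]
    simp only [← hbad]
    rwa [← Finset.sum_mul_sum, ← hA, ← hA]
  obtain ⟨q, _, hq⟩ := Finset.exists_lt_of_sum_lt h'
  exact ⟨q.1, q.2, hq⟩

/-- A set of pairs over `(V_i ∩ A) × (V_j ∩ B)` all of whose extensions by points of `C` are
exceptional is small: it has `|C|` exceptional extensions per pair. -/
theorem card_mul_card_le_of_forall_mem (P : Decomposition W t ℓ) {i j : Fin t}
    {C : Finset W} {bad : Finset (W × W × W)} {Q : Finset (W × W)}
    (hQ : Q ⊆ P.part i ×ˢ P.part j) (h : ∀ q ∈ Q, ∀ z ∈ C, (q.1, q.2, z) ∈ bad) :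
    Q.card * C.card ≤
      (P.triplesOver i j bad).card := by
  rw [← Finset.card_product]
  classical
  refine Finset.card_le_card_of_injOn (fun p => (p.1.1, p.1.2, p.2)) ?_ ?_
  · rintro ⟨q, z⟩ hp
    obtain ⟨hq, hz⟩ := Finset.mem_product.1 (Finset.mem_coe.1 hp)
    exact Finset.mem_coe.2 (Finset.mem_filter.2 ⟨h q hq z hz, Finset.mem_product.1 (hQ hq)⟩)
  · rintro ⟨⟨x, y⟩, z⟩ _ ⟨⟨x', y'⟩, z'⟩ _ heq
    simp only [Prod.mk.injEq] at heq ⊢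
    tauto

open Classical in
/-- The pairs of a cell over `A × B` at which the truth value of `F` differs from that of `s`. -/
def mismatches (P : Decomposition W t ℓ) (i j : Fin t) (a : Fin ℓ) (A B : Finset W)
    (F : W → W → Prop) (s : Prop) : Finset (W × W) :=
  (P.cell i j a).filter fun q => q.1 ∈ A ∧ q.2 ∈ B ∧ ¬ (F q.1 q.2 ↔ s)

theorem mem_mismatches {P : Decomposition W t ℓ} {i j : Fin t} {a : Fin ℓ} {A B : Finset W}
    {F : W → W → Prop} {s : Prop} {q : W × W} : q ∈ P.mismatches i j a A B F s ↔
      q ∈ P.cell i j a ∧ q.1 ∈ A ∧ q.2 ∈ B ∧ ¬ (F q.1 q.2 ↔ s) := by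
  classical
  exact Finset.mem_filter

open Classical in
/-- If membership of `xyz` in `H` does not depend on `z ∈ C`, then it is nearly constant on every
cell that carries a good triple. -/
theorem IsGoodTriple.exists_pattern [Fintype W] {P : Decomposition W t ℓ} {H : Hypergraph W}
    {A B C : Finset W} {η μ θ δ₁ δ₂ : ℝ} (hη : 0 < η) (hθ : 0 ≤ θ) (hθ1 : θ ≤ 1)
    (h₁ : δ₁ ≤ θ ^ 8) (h₂ : δ₂ ≤ θ ^ 8) {F : W → W → Prop}
    (hF : ∀ x ∈ A, ∀ y ∈ B, ∀ z ∈ C, ({x, y, z} : Set W) ∈ H.edgeSet ↔ F x y)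
    {x y z : W} {i j : Fin t} {a : Fin ℓ} (hcell : (x, y) ∈ P.cell i j a)
    (hgood : P.IsGoodTriple H.toTrigraph A B C η μ δ₁ δ₂ (x, y, z)) :
    ∃ s : Prop, η ^ 5 * ((P.mismatches i j a A B F s).card : ℝ) ≤
      8 * θ * ((P.part i ∩ A).card * (P.part j ∩ B).card) := by
  obtain ⟨i', j', k, a', b, c, htri, hdev, hi, hj, hk, -, -, hXZ, hYZ⟩ := hgood
  obtain ⟨hV, hc1, -, -⟩ : (x ∈ P.part i' ∧ y ∈ P.part j' ∧ z ∈ P.part k) ∧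
      (x, y) ∈ P.cell i' j' a' ∧ (y, z) ∈ P.cell j' k c ∧ (x, z) ∈ P.cell i' k b := by
    simpa [Triad.triangles, Decomposition.triad] using htri
  obtain ⟨hxi, hyj⟩ := Finset.mem_product.1 (P.cell_subset i j a hcell)
  obtain rfl := P.part_injective_of_mem hxi hV.1
  obtain rfl := P.part_injective_of_mem hyj hV.2.1
  obtain rfl := (P.existsUnique_cell i j x hxi y hyj).unique hcell hc1
  set T := P.triad i j k a b c
  set p := (H.toTrigraph.restrict T).relDensity T with hp
  -- The majority pattern: a pair that violates it has `|h| ≥ 1 / 2` on all triangles above it.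
  refine ⟨1 / 2 ≤ p, ?_⟩
  set S := P.mismatches i j a A B F (1 / 2 ≤ p)
  have hbal : ∀ x y z, (x, y) ∈ S → z ∈ P.part k ∩ C → (x, y, z) ∈ T.triangles →
      (H.toTrigraph.restrict T).relBalanced T x y z = if 1 / 2 ≤ p then -p else 1 - p := by
    intro x y z hxy hz ht
    obtain ⟨-, hxA, hyB, hne⟩ := mem_mismatches.1 hxy
    have hmem : (x, y, z) ∈ (H.toTrigraph.restrict T).edges ↔ F x y := by
      rw [← hF x hxA y hyB z (Finset.mem_inter.1 hz).2]
      simp [Trigraph.restrict, Hypergraph.toTrigraph, ht]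
    rw [Trigraph.relBalanced, if_pos ht]
    simp only [hmem]
    by_cases h : 1 / 2 ≤ p
    · have : ¬ F x y := fun hxy => hne (iff_of_true hxy h)
      rw [if_neg this, if_pos h]
    · have : F x y := by_contra fun hxy => hne (iff_of_false hxy h)
      rw [if_pos this, if_neg h]
  have hc : 1 / 2 ≤ |if 1 / 2 ≤ p then -p else 1 - p| := by
    split_ifs with h
    · rw [abs_neg]; exact h.trans (le_abs_self p)
    · exact le_trans (by linarith) (le_abs_self (1 - p))
  have key := hdev.card_le hη hθ hθ1 h₁ h₂ hXZ hYZ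
    (Finset.inter_subset_left : P.part k ∩ C ⊆ P.part k) hk ⟨z, hV.2.2⟩
    (Finset.filter_subset _ _ : S ⊆ P.cell i j a) hc hbal
  calc η ^ 5 * (S.card : ℝ) = η ^ 2 * (η ^ 3 * S.card) := by ring
    _ ≤ η ^ 2 * (8 * θ * ((P.part i).card * (P.part j).card)) :=
      mul_le_mul_of_nonneg_left key (by positivity)
    _ = 8 * θ * ((η * (P.part i).card) * (η * (P.part j).card)) := by ring
    _ ≤ _ := by gcongr

end Decomposition

/-- In an irreducible bigraph, fewer than `|U|` neighbourhood patterns on `V` miss the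
neighbourhood of some `u ∈ U`. -/
theorem Bigraph.Irreducible.exists_avoiding {α β : Type*} {G : Bigraph α β} (hG : G.Irreducible)
    {ℓ : ℕ} (hℓ : ℓ < G.left.card) (s : Fin ℓ → G.right → Prop) :
    ∃ u : G.left, ∀ a, ∃ v : G.right, ¬ ((u.1, v.1) ∈ G.edges ↔ s a v) := by
  by_contra! h
  choose f hf using h
  have hinj : Function.Injective f := fun u u' huu => Subtype.ext <|
    hG.1 u.1 u.2 u'.1 u'.2 fun z hz => (hf u ⟨z, hz⟩).trans (by rw [huu]; exact (hf u' ⟨z, hz⟩).symm)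
  have := Fintype.card_le_of_injective f hinj
  simp at this
  omega

open Classical in
theorem SimpleGraph.pairDensity_eq {W : Type*} (G : SimpleGraph W) (X Y : Finset W) :
    G.pairDensity X Y =
      (((X ×ˢ Y).filter fun p => G.Adj p.1 p.2).card : ℝ) / (X.card * Y.card) := by
  simp [SimpleGraph.pairDensity, SimpleGraph.edgeDensity, Rel.edgeDensity, Rel.interedges]

/-! ### The lower bound on the number of cells -/

theorem BipartiteColoredGraph.card_le_of_isBlowup {α β W : Type*} [Fintype W] {G : Bigraph α β}
    {m n : ℕ} {Γ : BipartiteColoredGraph G.left W} (hm : m * G.right.card = n)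
    (hA : Γ.A.card = n) (hB : Γ.B.card = n) {C : G.right → Finset W} (hC : ∀ v, (C v).card = m)
    (hcov : ∀ w : W, w ∈ Γ.A ∨ w ∈ Γ.B ∨ ∃ v, w ∈ C v) : Fintype.card W ≤ 3 * n := by
  classical
  have hsub : (Finset.univ : Finset W) ⊆ Γ.A ∪ (Γ.B ∪ Finset.univ.biUnion C) := by
    intro w _
    simpa using hcov w
  have h1 : (Finset.univ.biUnion C).card ≤ n := by
    refine Finset.card_biUnion_le.trans ?_
    simp [hC, ← hm, mul_comm]
  have h2 := Finset.card_le_card hsub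
  have h3 := Finset.card_union_le Γ.A (Γ.B ∪ Finset.univ.biUnion C)
  have h4 := Finset.card_union_le Γ.B (Finset.univ.biUnion C)
  rw [Finset.card_univ] at h2
  omega

/-- Over `A × B × C_v`, the edges of a blowup are determined by the colour of the pair in
`A × B`. -/
theorem BipartiteColoredGraph.mem_edgeSet_iff {α β W : Type*} {G : Bigraph α β}
    {Γ : BipartiteColoredGraph G.left W} {H : Hypergraph W} {C : G.right → Finset W}
    (hin : ∀ u : G.left, ∀ v : G.right, (u.1, v.1) ∈ G.edges →
      ∀ x y z, (Γ.color u).Adj x y → z ∈ C v → ({x, y, z} : Set W) ∈ H.edgeSet)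
    (hout : ∀ u : G.left, ∀ v : G.right, (u.1, v.1) ∉ G.edges →
      ∀ x y z, (Γ.color u).Adj x y → z ∈ C v → ({x, y, z} : Set W) ∉ H.edgeSet)
    {x y z : W} {v : G.right} (hx : x ∈ Γ.A) (hy : y ∈ Γ.B) (hz : z ∈ C v) :
    ({x, y, z} : Set W) ∈ H.edgeSet ↔ ∃ u, (Γ.color u).Adj x y ∧ (u.1, v.1) ∈ G.edges := by
  obtain ⟨u, hu, -⟩ := Γ.existsUnique_color x hx y hy
  constructor
  · intro h
    refine ⟨u, hu, by_contra fun hne => hout u v hne x y z hu hz h⟩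
  · rintro ⟨u', hu', hE⟩
    exact hin u' v hE x y z hu' hz

/-- With `η = r²⁰` and `μ = η n / t`, each source of exceptional triples over one `C_v` contributes
`O(η n³ / r)`; powers of `r ≤ 1 / 2` absorb the constant and the number `|V| ≤ 1 / r` of sets
`C_v`. -/
theorem Decomposition.sum_card_badTriples_lt {α β W : Type*} [Fintype W] {G : Bigraph α β}
    {r δ₁ δ₂ : ℝ} (hr0 : 0 < r) (hr : r ≤ 1 / 2) (hV : G.right.card * r ≤ 1)
    {n t ℓ : ℕ} (hn : 1 ≤ n) (ht : 1 ≤ t) (hℓ : ℓ * r ≤ 1) (hW : Fintype.card W ≤ 3 * n)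
    (A B : Finset W) (hA : A.card = n) (hB : B.card = n) (C : G.right → Finset W)
    {H : Hypergraph W} {P : Decomposition W t ℓ} (hδ : δ₁ ≤ r ^ 20) (hP : P.IsRegular H δ₁ δ₂) :
    ∑ v, ((P.badTriples H.toTrigraph A B (C v) (r ^ 20) (r ^ 20 / t * n) δ₁ δ₂).card : ℝ) <
      r ^ 9 * n * (A.card * B.card) := by
  have hn' : (1 : ℝ) ≤ n := by exact_mod_cast hn
  have ht' : (1 : ℝ) ≤ t := by exact_mod_cast ht
  have hW' : (Fintype.card W : ℝ) ≤ 3 * n := by exact_mod_cast hW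
  set η := r ^ 20 with hη
  have hη0 : 0 < η := by positivity
  have hone : ∀ v, ((P.badTriples H.toTrigraph A B (C v) η (η / t * n) δ₁ δ₂).card : ℝ) ≤
      r ^ 11 * n ^ 3 := by
    intro v
    refine (P.card_badTriples_le H A B (C v) hη0.le (by positivity) hP).trans ?_
    have e1 : 2 * t * (η / t * n) * (Fintype.card W : ℝ) ^ 2 =
        2 * η * n * (Fintype.card W : ℝ) ^ 2 := by field_simp
    rw [e1]
    have e2 : δ₁ + (3 + 2 * ℓ) * η ≤ (4 + 2 * ℓ) * η := by linarith
    have e3 : (4 + 2 * ℓ) * η * (3 * n) ^ 3 + 2 * η * n * (3 * n) ^ 2 =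
        (126 * r + 54 * (ℓ * r)) * r ^ 19 * n ^ 3 := by rw [hη]; ring
    have e4 : r ^ 8 ≤ (1 / 2) ^ 8 := pow_le_pow_left₀ hr0.le hr 8
    calc _ ≤ (4 + 2 * ℓ) * η * (3 * n) ^ 3 + 2 * η * n * (3 * n) ^ 2 := by gcongr
      _ = _ := e3
      _ ≤ (256 * r ^ 8) * r ^ 11 * n ^ 3 := by
          have : (126 * r + 54 * (ℓ * r)) ≤ 256 := by linarith
          calc _ ≤ 256 * r ^ 19 * n ^ 3 := by gcongr
            _ = _ := by ring
      _ ≤ 1 * r ^ 11 * n ^ 3 := by gcongr; linarith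
      _ = _ := by ring
  have hr1 : r ^ 10 < r ^ 9 := pow_lt_pow_right_of_lt_one₀ hr0 (by linarith) (by norm_num)
  calc _ ≤ ∑ _v : G.right, r ^ 11 * (n : ℝ) ^ 3 := Finset.sum_le_sum fun v _ => hone v
    _ = (G.right.card * r) * (r ^ 10 * n ^ 3) := by simp; ring
    _ ≤ 1 * (r ^ 10 * n ^ 3) := by gcongr
    _ < 1 * (r ^ 9 * n ^ 3) := by gcongr
    _ = _ := by rw [hA, hB]; ring

/-- A regular decomposition of a blowup has at least `|U|` cells between two parts, once all
parameters are polynomially small in `r ≤ min {1 / |U|, 1 / |V|}`. -/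
theorem Decomposition.IsRegular.card_left_le {α β W : Type*} [Fintype W] {G : Bigraph α β}
    (hVne : G.right.Nonempty) (hG : G.Irreducible) {r δ₁ δ₂ : ℝ} (hr0 : 0 < r) (hr : r ≤ 1 / 2)
    (hU : G.left.card * r ≤ 1) (hV : G.right.card * r ≤ 1) {m n t ℓ : ℕ} (hn : 1 ≤ n)
    (hm : m * G.right.card = n) (ht : 1 ≤ t) {Γ : BipartiteColoredGraph G.left W}
    {H : Hypergraph W} (hA : Γ.A.card = n) (hB : Γ.B.card = n)
    (hΓ : ∀ u, (Γ.color u).IsEpsRegular Γ.A Γ.B (r ^ 20 / t) ∧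
      |(Γ.color u).pairDensity Γ.A Γ.B - (G.left.card : ℝ)⁻¹| ≤ r ^ 20 / t)
    (hH : IsBlowup G m Γ H) {P : Decomposition W t ℓ} (h₁ : δ₁ ≤ (r ^ 110) ^ 8)
    (h₂ : δ₂ ≤ (r ^ 110) ^ 8) (hP : P.IsRegular H δ₁ δ₂) : G.left.card ≤ ℓ := by
  classical
  by_contra! hℓ
  obtain ⟨-, -, C, hC, -, -, hcov, hin, hout⟩ := hH
  have hr1 : r ≤ 1 := by linarith
  have hn' : (1 : ℝ) ≤ n := by exact_mod_cast hn
  have hm' : (m : ℝ) * G.right.card = n := by exact_mod_cast hm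
  have hV0 : (0 : ℝ) < G.right.card := by exact_mod_cast hVne.card_pos
  have hm0 : (0 : ℝ) < m := pos_of_mul_pos_left (hm' ▸ one_pos.trans_le hn') hV0.le
  have hsplit : ∀ c : ℝ, r ^ 9 * n * c = (G.right.card * r) * (r ^ 8 * c * m) := fun c => by
    rw [← hm']; ring
  have hW := BipartiteColoredGraph.card_le_of_isBlowup hm hA hB hC hcov
  have hℓr : ℓ * r ≤ 1 :=
    (mul_le_mul_of_nonneg_right (by exact_mod_cast hℓ.le) hr0.le).trans hU
  have hδ : δ₁ ≤ r ^ 20 := by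
    rw [← pow_mul] at h₁
    exact h₁.trans (pow_le_pow_of_le_one hr0.le hr1 (by norm_num))
  set η := r ^ 20 with hη
  have hη0 : 0 < η := by positivity
  set bad := fun v => P.badTriples H.toTrigraph Γ.A Γ.B (C v) η (η / t * n) δ₁ δ₂ with hbad
  obtain ⟨i, j, hij⟩ := P.exists_parts_sum_card_lt Γ.A Γ.B bad
    (P.sum_card_badTriples_lt hr0 hr hV hn ht hℓr hW Γ.A Γ.B hA hB C hδ hP)
  have hgood : ∀ v, ∀ x ∈ Γ.A, ∀ y ∈ Γ.B, ∀ z ∈ C v, (x, y, z) ∉ bad v →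
      P.IsGoodTriple H.toTrigraph Γ.A Γ.B (C v) η (η / t * n) δ₁ δ₂ (x, y, z) := by
    intro v x hx y hy z hz hnot
    by_contra hng
    exact hnot (Finset.mem_filter.2 ⟨by simp [hx, hy, hz], hng⟩)
  clear_value bad η
  clear hbad
  set X := P.part i ∩ Γ.A with hX
  set Y := P.part j ∩ Γ.B with hY
  have hXY0 : (0 : ℝ) < X.card * Y.card := by
    have h0 : 0 < r ^ 9 * n * (X.card * Y.card) :=
      (Finset.sum_nonneg fun _ _ => Nat.cast_nonneg _).trans_lt hij
    exact pos_of_mul_pos_right h0 (by positivity)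
  -- Pairs none of whose extensions into `C v` is good are rare.
  have huncov : ∀ v, ∀ Q ⊆ X ×ˢ Y, (∀ q ∈ Q, ∀ z ∈ C v, (q.1, q.2, z) ∈ bad v) →
      (Q.card : ℝ) ≤ r ^ 8 * (X.card * Y.card) := by
    intro v Q hQ hQbad
    have hQ' : Q ⊆ P.part i ×ˢ P.part j := hQ.trans
      (Finset.product_subset_product Finset.inter_subset_left Finset.inter_subset_left)
    have h1 := (Nat.cast_le (α := ℝ)).2 (P.card_mul_card_le_of_forall_mem hQ' hQbad)
    push_cast at h1
    rw [hC v] at h1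
    have h2 : ((P.triplesOver i j (bad v)).card : ℝ) ≤
        r ^ 9 * n * (X.card * Y.card) := le_trans (Finset.single_le_sum
          (f := fun v => ((P.triplesOver i j (bad v)).card : ℝ))
          (fun _ _ => Nat.cast_nonneg _) (Finset.mem_univ v)) hij.le
    refine le_of_mul_le_mul_right ?_ hm0
    calc (Q.card : ℝ) * m ≤ _ := h1
      _ ≤ _ := h2
      _ = (G.right.card * r) * (r ^ 8 * (X.card * Y.card) * m) := hsplit _
      _ ≤ 1 * (r ^ 8 * (X.card * Y.card) * m) := by gcongr
      _ = _ := one_mul _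
  have hgood_of : ∀ v, ∀ q ∈ X ×ˢ Y, ∀ z ∈ C v, (q.1, q.2, z) ∉ bad v →
      P.IsGoodTriple H.toTrigraph Γ.A Γ.B (C v) η (η / t * n) δ₁ δ₂ (q.1, q.2, z) := by
    intro v q hq z hz hnot
    obtain ⟨hqX, hqY⟩ := Finset.mem_product.1 hq
    exact hgood v _ (Finset.mem_inter.1 hqX).2 _ (Finset.mem_inter.1 hqY).2 z hz hnot
  -- Some triple over `X × Y` is good, so `X` and `Y` are large enough for the regularity of `Γ`.
  obtain ⟨hXn, hYn⟩ : η / t * n ≤ X.card ∧ η / t * n ≤ Y.card := by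
    obtain ⟨v₀, hv₀⟩ := hVne
    by_contra hsmall
    have := huncov ⟨v₀, hv₀⟩ (X ×ˢ Y) subset_rfl fun q hq z hz => by
      by_contra hnot
      obtain ⟨i', j', k, a, b, c, htri, -, -, -, -, hi, hj, -, -⟩ := hgood_of _ q hq z hz hnot
      have hV : (q.1 ∈ P.part i' ∧ q.2 ∈ P.part j' ∧ z ∈ P.part k) := by
        simpa [Decomposition.triad] using (Finset.mem_filter.1 htri).1
      obtain ⟨hqX, hqY⟩ := Finset.mem_product.1 hq
      obtain rfl := P.part_injective_of_mem (Finset.mem_inter.1 hqX).1 hV.1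
      obtain rfl := P.part_injective_of_mem (Finset.mem_inter.1 hqY).1 hV.2.1
      exact hsmall ⟨hi, hj⟩
    rw [Finset.card_product] at this
    push_cast at this
    have h8 : r ^ 8 < 1 := pow_lt_one₀ hr0.le (by linarith) (by norm_num)
    have := mul_lt_mul_of_pos_right h8 hXY0
    linarith
  set F : G.right → W → W → Prop :=
    fun v x y => ∃ u, (Γ.color u).Adj x y ∧ (u.1, v.1) ∈ G.edges with hFdef
  have hpat : ∀ a v, ∃ s : Prop,
      ((P.mismatches i j a Γ.A Γ.B (F v) s).card : ℝ) ≤ r ^ 7 * (X.card * Y.card) := by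
    intro a v
    by_cases hcov : ∀ q ∈ P.cell i j a ∩ X ×ˢ Y, ∀ z ∈ C v, (q.1, q.2, z) ∈ bad v
    · refine ⟨True, ?_⟩
      have h1 := huncov v _ Finset.inter_subset_right hcov
      have hsub : P.mismatches i j a Γ.A Γ.B (F v) True ⊆ P.cell i j a ∩ X ×ˢ Y := by
        intro q hq
        obtain ⟨hq1, hq2, hq3, -⟩ := Decomposition.mem_mismatches.1 hq
        have := Finset.mem_product.1 (P.cell_subset i j a hq1)
        simp [hX, hY, hq1, hq2, hq3, this.1, this.2]
      have h2 : r ^ 8 ≤ r ^ 7 := pow_le_pow_of_le_one hr0.le hr1 (by norm_num)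
      calc _ ≤ ((P.cell i j a ∩ X ×ˢ Y).card : ℝ) := Nat.cast_le.2 (Finset.card_le_card hsub)
        _ ≤ _ := h1
        _ ≤ _ := by gcongr
    · push Not at hcov
      obtain ⟨q, hq, z, hz, hnot⟩ := hcov
      obtain ⟨hqc, hqXY⟩ := Finset.mem_inter.1 hq
      obtain ⟨s, hs⟩ := (hgood_of v q hqXY z hz hnot).exists_pattern (F := F v) hη0
        (by positivity) (pow_le_one₀ hr0.le hr1) h₁ h₂
        (fun x hx y hy z hz => BipartiteColoredGraph.mem_edgeSet_iff hin hout hx hy hz) hqc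
      refine ⟨s, ?_⟩
      refine le_of_mul_le_mul_left (hs.trans ?_) (by positivity : 0 < η ^ 5)
      have h3 : 8 * r ^ 3 ≤ 1 := by
        have := pow_le_pow_left₀ hr0.le hr 3
        linarith
      calc 8 * r ^ 110 * ((X.card : ℝ) * Y.card)
          = (8 * r ^ 3) * (r ^ 107 * (X.card * Y.card)) := by ring
        _ ≤ 1 * (r ^ 107 * (X.card * Y.card)) := by gcongr
        -- The exponent `107 = 5 · 20 + 7` is what makes the loss `η ^ 5` affordable.
        _ = η ^ 5 * (r ^ 7 * (X.card * Y.card)) := by rw [hη]; ring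
  choose s hs using hpat
  obtain ⟨u, hu⟩ := hG.exists_avoiding hℓ s
  set D := (X ×ˢ Y).filter fun p => (Γ.color u).Adj p.1 p.2 with hD
  -- The colour `u` is rare in every cell, hence in `X × Y`.
  have hDle : (D.card : ℝ) ≤ r ^ 6 * (X.card * Y.card) := by
    have hcell : ∀ a, ((D.filter fun q => q ∈ P.cell i j a).card : ℝ) ≤
        r ^ 7 * (X.card * Y.card) := by
      intro a
      obtain ⟨v, hv⟩ := hu a
      refine le_trans ?_ (hs a v)
      refine Nat.cast_le.2 (Finset.card_le_card fun q hq => ?_)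
      obtain ⟨hqD, hqc⟩ := Finset.mem_filter.1 hq
      obtain ⟨hqXY, hqu⟩ := Finset.mem_filter.1 hqD
      obtain ⟨hqX, hqY⟩ := Finset.mem_product.1 hqXY
      have hqA := (Finset.mem_inter.1 hqX).2
      have hqB := (Finset.mem_inter.1 hqY).2
      have hFu : F v q.1 q.2 ↔ (u.1, v.1) ∈ G.edges := by
        refine ⟨?_, fun h => ⟨u, hqu, h⟩⟩
        rintro ⟨u', hu', hE⟩
        rwa [(Γ.existsUnique_color _ hqA _ hqB).unique hqu hu']
      refine Decomposition.mem_mismatches.2 ⟨hqc, hqA, hqB, ?_⟩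
      rwa [hFu]
    have hsub : D ⊆ Finset.univ.biUnion fun a => D.filter fun q => q ∈ P.cell i j a := by
      intro q hq
      obtain ⟨hqX, hqY⟩ := Finset.mem_product.1 (Finset.mem_filter.1 hq).1
      obtain ⟨a, ha, -⟩ := P.existsUnique_cell i j q.1 (Finset.mem_inter.1 hqX).1 q.2
        (Finset.mem_inter.1 hqY).1
      exact Finset.mem_biUnion.2 ⟨a, Finset.mem_univ _, Finset.mem_filter.2 ⟨hq, ha⟩⟩
    have h1 := (Nat.cast_le (α := ℝ)).2
      ((Finset.card_le_card hsub).trans Finset.card_biUnion_le)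
    push_cast at h1
    calc (D.card : ℝ) ≤ _ := h1
      _ ≤ ∑ _a : Fin ℓ, r ^ 7 * ((X.card : ℝ) * Y.card) := Finset.sum_le_sum fun a _ => hcell a
      _ = (ℓ * r) * (r ^ 6 * (X.card * Y.card)) := by simp; ring
      _ ≤ 1 * (r ^ 6 * (X.card * Y.card)) := by gcongr
      _ = _ := one_mul _
  have hdens : (Γ.color u).pairDensity X Y ≤ r ^ 6 := by
    rw [SimpleGraph.pairDensity_eq, div_le_iff₀ hXY0]
    exact hDle
  have hreg := (hΓ u).1 X Finset.inter_subset_right Y Finset.inter_subset_right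
    (by rw [hA]; exact hXn) (by rw [hB]; exact hYn)
  have hU0 : (0 : ℝ) < G.left.card := by exact_mod_cast Finset.card_pos.2 ⟨u.1, u.2⟩
  have hrU : r ≤ (G.left.card : ℝ)⁻¹ := by
    rw [le_inv_comm₀ hr0 hU0, ← one_div, le_div_iff₀ hr0]
    exact hU
  have hεη : η / t ≤ η := div_le_self hη0.le (by exact_mod_cast ht)
  have e1 : r ^ 6 ≤ r * (1 / 2) ^ 5 := by
    rw [pow_succ']; gcongr
  have e2 : η ≤ r * (1 / 2) ^ 5 := hη ▸ (pow_le_pow_of_le_one hr0.le hr1 (by norm_num)).trans e1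
  linarith [(abs_le.1 hreg).2, (abs_le.1 (hΓ u).2).1]

end

theorem mainTheorem9 :
    ∃ K₁ εs : ℝ, 0 < K₁ ∧ 0 < εs ∧
      ∀ (α β : Type*) (G : Bigraph α β), G.left.Nonempty → G.right.Nonempty → G.Irreducible →
      ∀ ε₁ : ℝ, 0 < ε₁ →
        ε₁ < min (min ((G.left.card : ℝ) ^ (-K₁)) ((G.right.card : ℝ) ^ (-K₁))) (εs ^ K₁) →
      ∃ ε₂s : ℕ → ℝ, (∀ x, 0 < ε₂s x ∧ ε₂s x < 1) ∧
      ∀ t : ℕ, 1 ≤ t →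
      ∀ ε₂ : ℕ → ℝ, (∀ x, 0 < ε₂ x ∧ ε₂ x < 1) → (∀ x, ε₂ x < ε₂s x) →
      ∃ ε : ℝ, 0 < ε ∧
      ∃ n₀ : ℕ, ∀ n : ℕ, n₀ ≤ n → ∀ m : ℕ, m * G.right.card = n →
      ∀ (W : Type*) [Fintype W] (Γ : BipartiteColoredGraph G.left W) (H : Hypergraph W),
        Γ.A.card = n → Γ.B.card = n →
        (∀ u, (Γ.color u).IsEpsRegular Γ.A Γ.B ε ∧
          |(Γ.color u).pairDensity Γ.A Γ.B - (G.left.card : ℝ)⁻¹| ≤ ε) →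
        IsBlowup G m Γ H →
      ∀ ℓ : ℕ, 1 ≤ ℓ → ∀ P : Decomposition W t ℓ,
        P.IsRegular H (ε₁ ^ K₁) (ε₂ ℓ ^ K₁) →
        G.left.card ≤ ℓ := by
  -- With `r = 1 / max {|U|, |V|}`, both error parameters are below `(r¹⁰⁰)¹⁰⁰`, far less than the
  -- required `r⁸⁸⁰`. If `|U| = 1` there is nothing to prove, so `r ≤ 1 / 2` replaces a small `εs`.
  refine ⟨100, 1, by norm_num, one_pos, ?_⟩
  intro α β G hUne hVne hG ε₁ hε₁ hlt
  obtain ⟨hlt', hlt1⟩ := lt_min_iff.1 hlt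
  obtain ⟨hltU, hltV⟩ := lt_min_iff.1 hlt'
  rw [Real.one_rpow] at hlt1
  refine ⟨fun _ => ε₁, fun _ => ⟨hε₁, hlt1⟩, ?_⟩
  intro t ht ε₂ hε₂ hε₂s
  set M : ℕ := max G.left.card G.right.card with hM
  have hM1 : 1 ≤ M := hUne.card_pos.trans_le (le_max_left _ _)
  have hM0 : (0 : ℝ) < M := by exact_mod_cast hM1
  have hMU : (G.left.card : ℝ) ≤ M := by exact_mod_cast le_max_left _ _
  have hMV : (G.right.card : ℝ) ≤ M := by exact_mod_cast le_max_right _ _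
  set r : ℝ := (M : ℝ)⁻¹ with hr
  have hr0 : 0 < r := inv_pos.2 hM0
  have hr1 : r ≤ 1 := inv_le_one_of_one_le₀ (by exact_mod_cast hM1)
  have hεr : ε₁ ≤ r ^ 100 := by
    have key : ε₁ < (M : ℝ) ^ (-100 : ℝ) := by
      rcases max_choice G.left.card G.right.card with h | h
      · rwa [hM, h]
      · rwa [hM, h]
    rw [Real.rpow_neg hM0.le] at key
    rw [hr, inv_pow]
    exact_mod_cast key.le
  have hpow : ∀ x : ℝ, 0 < x → x ≤ ε₁ → x ^ (100 : ℝ) ≤ (r ^ 110) ^ 8 := by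
    intro x hx0 hx
    calc x ^ (100 : ℝ) = x ^ 100 := by exact_mod_cast Real.rpow_natCast x 100
      _ ≤ (r ^ 100) ^ 100 := pow_le_pow_left₀ hx0.le (hx.trans hεr) _
      _ = r ^ 10000 := by rw [← pow_mul]
      _ ≤ r ^ 880 := pow_le_pow_of_le_one hr0.le hr1 (by norm_num)
      _ = _ := by rw [← pow_mul]
  have ht0 : (0 : ℝ) < t := by exact_mod_cast ht
  refine ⟨r ^ 20 / t, by positivity, 1, ?_⟩
  intro n hn m hm W _ Γ H hA hB hΓ hH ℓ hℓ P hP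
  rcases Nat.eq_or_lt_of_le (Nat.succ_le_of_lt hUne.card_pos) with h1 | h1
  · omega
  have hM2 : 2 ≤ M := h1.trans_le (le_max_left _ _)
  have hr2 : r ≤ 1 / 2 := by
    rw [hr, ← one_div]
    exact one_div_le_one_div_of_le two_pos (by exact_mod_cast hM2)
  have hle : ∀ x : ℝ, x ≤ M → x * r ≤ 1 := fun x hx => by
    rw [hr, ← div_eq_mul_inv]
    exact (div_le_one hM0).2 hx
  exact hP.card_left_le hVne hG hr0 hr2 (hle _ hMU) (hle _ hMV) hn hm ht hA hB hΓ hH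
    (hpow ε₁ hε₁ le_rfl) (hpow (ε₂ ℓ) (hε₂ ℓ).1 (hε₂s ℓ).le)
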